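/- Let $T=\mathbb R/\mathbb Z$ and let $C(T)$ be the space of real continuous functions on $T$ with the sup norm $\|\cdot\|$. For integers $n,k\ge 1$ put $r=2k$ and use the following notation. - $E_n(f)=\inf_{\tau}\|f-\tau\|$, the infimum over all real $1$-periodic trigonometric polynomials $\tau(x)=\sum_{j=0}^{n-1}(\alpha_j\cos 2\pi jx+\beta_j\sin 2\pi jx)$ of degree at most $n-1$. - $\gamma_r^*=\binom{2k}{k}^{-1}$, $\;a_j=\binom{2k}{k+j}\big/\binom{2k}{k}$, and $\mu_r\ge 0$ is given by $\mu_r^2=\dfrac{8}{\pi^2}\displaystyle\sum_{1\le j\le k,\ j\text{ odd}}\frac{a_j}{j^2}$. - $\chi_h$ is the characteristic function of $(-h/2,h/2)$ divided by $h$, and $\chi_h^2=\chi_h*\chi_h$ is its convolution square on $\mathbb R$. - $\widehat\Delta_t^{2k}f(x)=\sum_{j=-k}^{k}(-1)^j\binom{2k}{k+j}f(x+jt)$ and $W_{2k}(f,\phi,x)=\binom{2k}{k}^{-1}\int_{\mathbb R}\widehat\Delta_t^{2k}f(x)\,\phi(t)\,dt$. - $K^*_{n,r}(\phi)$ is the sharp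 constant $K$ in the inequality $E_n(f)\le K\,\big\|(\gamma_r^*)^{-1}W_{2k}(f,\phi,\cdot)\big\|$ for $f\in C(T)$, that is, $$K^*_{n,r}(\phi)=\sup_{f\in C(T)}\frac{E_n(f)}{\big\|\int_{\mathbb R}\widehat\Delta_t^{2k}f(\cdot)\,\phi(t)\,dt\big\|}\in[0,\infty],$$ where $0/0=0$ and $a/0=\infty$ for $a>0$. **Theorem 6.** For all $n\ge 1$ and all even $r=2k\ge 2$, $$\frac{\gamma_r^*}{1-\mu_r^2}\;\le\;K^*_{n,r}\big(\chi^2_{1/(2n)}\big)\;\le\;\frac{4}{\pi}\,\frac{\gamma_r^*}{1-\mu_r^2},$$ where $$\frac{\gamma_r^*}{1-\mu_r^2}\asymp\sqrt r\,\gamma_r^*\asymp\frac{r}{2^r}$$ with absolute constants, uniformly over all even $r\ge 2$. -/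

import Mathlib

open MeasureTheory
open scoped ENNReal

noncomputable section

namespace Stechkin

/-- `T_{2n-1}`: the real trigonometric polynomials of degree at most `n - 1` on `T = ℝ / ℤ`,
inside the space `C(T)` of continuous functions with the sup norm. -/
def trigPoly (n : ℕ) : Set C(UnitAddCircle, ℝ) :=
  {p | ∃ a b : ℕ → ℝ, ∀ x : ℝ, p (x : UnitAddCircle) =
    ∑ j ∈ Finset.range n,
      (a j * Real.cos (2 * Real.pi * j * x) + b j * Real.sin (2 * Real.pi * j * x))}

/-- `E_n(f)`: the best uniform approximation of `f` by trigonometric polynomials of degree at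
most `n - 1`. -/
def bestApprox (n : ℕ) (f : C(UnitAddCircle, ℝ)) : ℝ :=
  ⨅ p : trigPoly n, ‖f - p.1‖

/-- The function `χ_h`: the indicator of `(-h/2, h/2)`, normalised to have integral one. -/
def chi (h : ℝ) : ℝ → ℝ :=
  (Set.Ioo (-(h / 2)) (h / 2)).indicator fun _ => 1 / h

/-- `χ_h²`: the convolution square of `χ_h` on the real line. -/
def chiSq (h : ℝ) : ℝ → ℝ :=
  convolution (chi h) (chi h) (ContinuousLinearMap.mul ℝ ℝ) volume

/-- The symmetric difference `∑_{j=-k}^{k} (-1)^j binom(2k, k+j) f(x + j t)`. -/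
def symmDiff (k : ℕ) (f : C(UnitAddCircle, ℝ)) (t : ℝ) (x : UnitAddCircle) : ℝ :=
  ∑ j ∈ Finset.Icc (-(k : ℤ)) (k : ℤ),
    (j.negOnePow : ℝ) * ((2 * k).choose ((k : ℤ) + j).toNat : ℝ)
      * f (x + ((j * t : ℝ) : UnitAddCircle))

/-- `γ*_r`, the inverse of the central binomial coefficient: `1 / binom(2k, k)` for `r = 2k` and
`1 / binom(2k-1, k-1)` for `r = 2k - 1`. -/
def gammaStar (r : ℕ) : ℝ := ((r.choose (r / 2) : ℕ) : ℝ)⁻¹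

/-- `W_{2k}(f, φ, x) = binom(2k, k)⁻¹ ∫_ℝ Δ̂_t^{2k} f(x) φ(t) dt`. -/
def W (k : ℕ) (f : C(UnitAddCircle, ℝ)) (φ : ℝ → ℝ) (x : UnitAddCircle) : ℝ :=
  ((2 * k).choose k : ℝ)⁻¹ * ∫ t : ℝ, symmDiff k f t x * φ t

/-- The sharp constant `K*_{n,2k}(φ)` in `E_n(f) ≤ K ‖(γ*_{2k})⁻¹ W_{2k}(f, φ, ·)‖`, `f ∈ C(T)`,
as an extended nonnegative real: the supremum of the quotients, where `0 / 0 = 0` and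
`a / 0 = ∞` for `a > 0`. Here `(γ*_{2k})⁻¹ W_{2k}(f, φ, x)` is the mean of the differences
`Δ̂_t^{2k} f(x)` with weight `φ(t)`. -/
def Kstar (n k : ℕ) (φ : ℝ → ℝ) : ℝ≥0∞ :=
  ⨆ f : C(UnitAddCircle, ℝ),
    ENNReal.ofReal (bestApprox n f) / ⨆ x : UnitAddCircle, ‖(gammaStar (2 * k))⁻¹ * W k f φ x‖ₑ

/-- `a_j = binom(2k, k+j) / binom(2k, k)`. -/
def coeffA (k j : ℕ) : ℝ := ((2 * k).choose (k + j) : ℝ) / ((2 * k).choose k : ℝ)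

/-- `μ_{2k}`, the nonnegative number with
`μ_{2k}² = (8 / π²) ∑_{1 ≤ j ≤ k, j odd} a_j / j²`. -/
def mu (k : ℕ) : ℝ :=
  Real.sqrt (8 / Real.pi ^ 2 * ∑ j ∈ (Finset.Icc 1 k).filter Odd, coeffA k j / (j : ℝ) ^ 2)

end Stechkin

end

noncomputable section

namespace Stechkin

/-! The averaged difference is a Fourier multiplier operator on `C(T)`. For h = 1/(2n) the transform
of χ_h² turns its symbol into w(m) = 1 - d(m)/m², where d is the symbol of a finite combination D
(`diffOp`) of translations. Two estimates allow w to be inverted on |m| ≥ n, which is all that E_n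
sees (`bestApprox_le`).

First, D has norm at most n²μ² (`norm_diffOp_le`). The weights a_j/j² decrease, so the identity and
translation parts of D have total mass 2∑_{j odd} a_j/j² times 4n²/π². Second, division by |m|^{p+1}
on |m| ≥ n is realised by an operator of norm at most (4/π)n^{-(p+1)} (`norm_favard_le`). This comes
from writing |m|^{-(p+1)} as a Laplace integral of e^{-u|m|} and interpolating each e^{-u|m|} by a
Poisson kernel times a cosine.

The Neumann series ∑ (d/m²)^s then has s-th term of norm at most (4/π)μ^{2s}. All divisions by m² in
one term are done by a single operator, so 4/π enters once rather than to the power s. Summing gives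
(4/π)/(1-μ²).

For the lower bound, cos 2πnx is an eigenfunction with eigenvalue w(n) = 1 - μ², and its distance to
the polynomials is at least 1, by alternation at the points i/(2n).

Evaluating the same symbol at n = 1 writes 1 - μ² as 4^k binom(2k,k)⁻¹ times an integral of (1/2 -
t) sin^{2k}(πt). Comparing 1/2 - t with cos πt gives that integral the order 1/k, and yields both μ²
< 1 and the asymptotics. -/

/-! ### Translations and Fourier coefficients on `C(T)`. -/

/-- The translation operator `f ↦ f (· + t)` on `C(T)`. -/
def translate (t : UnitAddCircle) : C(UnitAddCircle, ℝ) →L[ℝ] C(UnitAddCircle, ℝ) :=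
  LinearMap.mkContinuous
    { toFun := fun f => f.comp ⟨fun x => x + t, by fun_prop⟩
      map_add' := fun _ _ => rfl
      map_smul' := fun _ _ => rfl } 1 fun f => by
    rw [one_mul]
    exact (ContinuousMap.norm_le _ (norm_nonneg f)).2 fun x => f.norm_coe_le_norm (x + t)

@[simp]
lemma translate_apply (t : UnitAddCircle) (f : C(UnitAddCircle, ℝ)) (x : UnitAddCircle) :
    translate t f x = f (x + t) := rfl

lemma norm_translate_le (t : UnitAddCircle) : ‖translate t‖ ≤ 1 :=
  LinearMap.mkContinuous_norm_le _ zero_le_one _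

lemma norm_translate_apply_le (t : UnitAddCircle) (f : C(UnitAddCircle, ℝ)) :
    ‖translate t f‖ ≤ ‖f‖ := by
  simpa using (translate t).le_of_opNorm_le (norm_translate_le t) f

lemma continuous_translate (f : C(UnitAddCircle, ℝ)) : Continuous fun t => translate t f := by
  let F : C(UnitAddCircle × UnitAddCircle, ℝ) := ⟨fun p => f (p.2 + p.1), by fun_prop⟩
  exact F.curry.continuous

lemma continuous_translate_coe (f : C(UnitAddCircle, ℝ)) (c : ℝ) :
    Continuous fun t : ℝ => translate ((c * t : ℝ) : UnitAddCircle) f :=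
  (continuous_translate f).comp ((AddCircle.continuous_mk' (1 : ℝ)).comp (by fun_prop))

/-- The Fourier coefficient functional on `C(T)`. -/
def coeff (m : ℤ) : C(UnitAddCircle, ℝ) →L[ℝ] ℂ :=
  LinearMap.mkContinuous
    { toFun := fun f => fourierCoeff (fun x => (f x : ℂ)) m
      map_add' := fun f g => by
        have hf : Integrable (fun x => (f x : ℂ)) AddCircle.haarAddCircle :=
          (Continuous.integrable_of_hasCompactSupport (by fun_prop)
            (HasCompactSupport.of_compactSpace _))
        have hg : Integrable (fun x => (g x : ℂ)) AddCircle.haarAddCircle :=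
          (Continuous.integrable_of_hasCompactSupport (by fun_prop)
            (HasCompactSupport.of_compactSpace _))
        refine Eq.trans ?_ (congrFun (fourierCoeff.add hf hg) m)
        congr 1
        ext x
        simp
      map_smul' := fun c f => by
        simp only [RingHom.id_apply, ContinuousMap.coe_smul, Pi.smul_apply, smul_eq_mul,
          Complex.ofReal_mul, Complex.real_smul]
        exact fourierCoeff.const_mul _ _ _ } 1 fun f => by
    rw [one_mul]
    refine (norm_integral_le_of_norm_le_const (C := ‖f‖) (ae_of_all _ fun x => ?_)).trans ?_
    · rw [norm_smul]
      have : ‖fourier (-m) x‖ = 1 := Circle.norm_coe _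
      rw [this, one_mul, Complex.norm_real]
      exact f.norm_coe_le_norm x
    · simp

lemma coeff_apply (m : ℤ) (f : C(UnitAddCircle, ℝ)) :
    coeff m f = ∫ x, fourier (-m) x * (f x : ℂ) ∂AddCircle.haarAddCircle := rfl

lemma coeff_translate (m : ℤ) (t : UnitAddCircle) (f : C(UnitAddCircle, ℝ)) :
    coeff m (translate t f) = fourier m t * coeff m f := by
  rw [coeff_apply, coeff_apply, ← integral_const_mul]
  rw [← integral_add_right_eq_self
    (fun x => fourier m t * (fourier (-m) x * (f x : ℂ))) t]
  refine integral_congr_ae (ae_of_all _ fun x => ?_)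
  have h : ∀ y : UnitAddCircle, fourier (-m) (x + y) = fourier (-m) x * fourier (-m) y := by
    intro y
    simp only [fourier_apply, smul_add, AddCircle.toCircle_add, Circle.coe_mul]
  have h2 : fourier m t * fourier (-m) t = 1 := by
    rw [← fourier_add, add_neg_cancel, fourier_zero]
  simp only [translate_apply, h]
  linear_combination (-fourier (-m) x * (f (x + t) : ℂ)) * h2

lemma integrable_smul_translate {μ : Measure ℝ} {K : ℝ → ℝ} (hK : Integrable K μ) (c : ℝ)
    (f : C(UnitAddCircle, ℝ)) :
    Integrable (fun t : ℝ => K t • translate ((c * t : ℝ) : UnitAddCircle) f) μ := by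
  refine (hK.norm.mul_const ‖f‖).mono'
    (hK.aestronglyMeasurable.smul (continuous_translate_coe f c).aestronglyMeasurable)
    (ae_of_all _ fun t => ?_)
  rw [norm_smul]
  gcongr
  exact norm_translate_apply_le _ _

lemma norm_integral_smul_translate_le {μ : Measure ℝ} {K : ℝ → ℝ} (hK : Integrable K μ) (c : ℝ)
    (f : C(UnitAddCircle, ℝ)) :
    ‖∫ t, K t • translate ((c * t : ℝ) : UnitAddCircle) f ∂μ‖ ≤ (∫ t, |K t| ∂μ) * ‖f‖ := by
  rw [← integral_mul_const]
  refine norm_integral_le_of_norm_le (hK.norm.mul_const ‖f‖) (ae_of_all _ fun t => ?_)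
  rw [norm_smul, Real.norm_eq_abs]
  gcongr
  exact norm_translate_apply_le _ _

/-- The integral is a Bochner integral in `C(T)`, so the continuous functional `coeff m` passes
under it, and each translation contributes a character. -/
lemma coeff_integral_smul_translate {μ : Measure ℝ} {K : ℝ → ℝ} (hK : Integrable K μ) (c : ℝ)
    (f : C(UnitAddCircle, ℝ)) (m : ℤ) :
    coeff m (∫ t, K t • translate ((c * t : ℝ) : UnitAddCircle) f ∂μ) =
      (∫ t, (K t : ℂ) * Complex.exp (2 * Real.pi * Complex.I * m * (c * t)) ∂μ) * coeff m f := by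
  rw [← ContinuousLinearMap.integral_comp_comm _ (integrable_smul_translate hK c f),
    ← integral_mul_const]
  refine integral_congr_ae (ae_of_all _ fun t => ?_)
  simp only [map_smul, coeff_translate, fourier_coe_apply, Complex.real_smul]
  push_cast
  ring_nf

/-- A continuous function whose Fourier coefficients vanish from `n` on is a trigonometric
polynomial of degree at most `n - 1`. -/
lemma mem_trigPoly_of_coeff_eq_zero {n : ℕ} {f : C(UnitAddCircle, ℝ)}
    (hf : ∀ m : ℤ, n ≤ m.natAbs → coeff m f = 0) : f ∈ trigPoly n := by
  classical
  let F : C(UnitAddCircle, ℂ) := ⟨fun x => (f x : ℂ), by fun_prop⟩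
  let S : Finset ℤ := Finset.Ioo (-(n : ℤ)) n
  have hS : ∀ m ∉ S, fourierCoeff F m = 0 := fun m hm => hf m (by
    simp only [S, Finset.mem_Ioo, not_and_or, not_lt] at hm; omega)
  have hsum := has_pointwise_sum_fourier_series_of_summable (f := F)
    (summable_of_ne_finset_zero hS)
  -- Frequencies m and -m are folded onto j = |m|; the sign restores the oddness of the sine and
  -- removes the term m = 0.
  refine ⟨fun j => ∑ m ∈ S with m.natAbs = j, (coeff m f).re,
    fun j => ∑ m ∈ S with m.natAbs = j, -(m.sign * (coeff m f).im), fun x => ?_⟩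
  have h1 : (f x : ℂ) = ∑ m ∈ S, coeff m f * fourier m (x : UnitAddCircle) := by
    refine (hsum (x : UnitAddCircle)).unique ?_
    refine hasSum_sum_of_ne_finset_zero fun m hm => ?_
    rw [hS m hm, zero_smul]
  have h2 : f x = ∑ m ∈ S, ((coeff m f).re * Real.cos (2 * Real.pi * m.natAbs * x)
      + -(m.sign * (coeff m f).im) * Real.sin (2 * Real.pi * m.natAbs * x)) := by
    have := congrArg Complex.re h1
    rw [Complex.ofReal_re, Complex.re_sum] at this
    rw [this]
    refine Finset.sum_congr rfl fun m _ => ?_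
    rw [fourier_coe_apply]
    have e : (2 * Real.pi * Complex.I * m * x / (1 : ℝ) : ℂ)
        = ((2 * Real.pi * m * x : ℝ) : ℂ) * Complex.I := by push_cast; ring
    rw [e, Complex.mul_re, Complex.exp_ofReal_mul_I_re, Complex.exp_ofReal_mul_I_im]
    rcases lt_trichotomy m 0 with h | h | h
    · have hm : ((m.natAbs : ℕ) : ℝ) = -(m : ℝ) := by
        rw [← Int.cast_natCast, Int.natCast_natAbs, abs_of_neg h]; simp
      rw [hm, Int.sign_eq_neg_one_of_neg h]
      have e2 : 2 * Real.pi * (-(m : ℝ)) * x = -(2 * Real.pi * m * x) := by ring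
      rw [e2, Real.cos_neg, Real.sin_neg]
      push_cast; ring
    · subst h; simp
    · have hm : ((m.natAbs : ℕ) : ℝ) = (m : ℝ) := by
        rw [← Int.cast_natCast, Int.natCast_natAbs, abs_of_pos h]
      rw [hm, Int.sign_eq_one_of_pos h]
      push_cast; ring
  rw [h2, ← Finset.sum_fiberwise_of_maps_to (t := Finset.range n) (g := Int.natAbs)]
  · refine Finset.sum_congr rfl fun j _ => ?_
    rw [Finset.sum_mul, Finset.sum_mul, ← Finset.sum_add_distrib]
    refine Finset.sum_congr rfl fun m hm => ?_
    rw [(Finset.mem_filter.1 hm).2]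
  · intro m hm
    simp only [S, Finset.mem_Ioo, Finset.mem_range] at hm ⊢
    omega

/-- Only frequencies |m| ≥ n matter: f - g is itself an admissible polynomial, with error g. -/
lemma bestApprox_le {n : ℕ} {f g : C(UnitAddCircle, ℝ)}
    (h : ∀ m : ℤ, n ≤ m.natAbs → coeff m g = coeff m f) : bestApprox n f ≤ ‖g‖ := by
  have hp : f - g ∈ trigPoly n := mem_trigPoly_of_coeff_eq_zero fun m hm => by
    rw [map_sub, h m hm, sub_self]
  have := ciInf_le (f := fun p : trigPoly n => ‖f - p.1‖)
    ⟨0, by rintro _ ⟨p, rfl⟩; exact norm_nonneg _⟩ ⟨f - g, hp⟩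
  simpa [bestApprox] using this

/-! ### Poisson kernel and the sign-changing interpolating kernel. -/

/-- The Poisson kernel of the unit disc at the real point `q`, in the variable `t ∈ ℝ / ℤ`. -/
def poisson (q t : ℝ) : ℝ := (1 - q ^ 2) / (1 - 2 * q * Real.cos (2 * Real.pi * t) + q ^ 2)

lemma poisson_denom_pos {q : ℝ} (h0 : 0 ≤ q) (h1 : q < 1) (t : ℝ) :
    0 < 1 - 2 * q * Real.cos (2 * Real.pi * t) + q ^ 2 := by
  nlinarith [Real.cos_le_one (2 * Real.pi * t),
    mul_nonneg h0 (sub_nonneg.2 (Real.cos_le_one (2 * Real.pi * t))), sq_pos_of_pos (sub_pos.2 h1)]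

lemma poisson_nonneg {q : ℝ} (h0 : 0 ≤ q) (h1 : q < 1) (t : ℝ) : 0 ≤ poisson q t :=
  div_nonneg (by nlinarith) (poisson_denom_pos h0 h1 t).le

lemma continuous_poisson {q : ℝ} (h0 : 0 ≤ q) (h1 : q < 1) : Continuous (poisson q) := by
  unfold poisson
  exact Continuous.div (by fun_prop) (by fun_prop) fun t => (poisson_denom_pos h0 h1 t).ne'

/-- Poisson's integral formula for z ↦ z^m on the unit disc, evaluated at z = q. -/
lemma integral_poisson_mul_exp {q : ℝ} (h0 : 0 ≤ q) (h1 : q < 1) (m : ℕ) :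
    ∫ t in (0 : ℝ)..1, (poisson q t : ℂ) * Complex.exp ((2 * Real.pi * m * t : ℝ) * Complex.I)
      = (q : ℂ) ^ m := by
  have hd : DiffContOnCl ℂ (fun z : ℂ => z ^ m) (Metric.ball 0 1) :=
    (by fun_prop : Differentiable ℂ fun z : ℂ => z ^ m).diffContOnCl
  have hq : (q : ℂ) ∈ Metric.ball (0 : ℂ) 1 := by
    simp [abs_of_nonneg h0, h1]
  have h := hd.circleAverage_poissonKernel_smul' hq
  rw [Real.circleAverage_def] at h
  have hs := intervalIntegral.smul_integral_comp_mul_left (a := 0) (b := 1) (fun θ : ℝ =>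
    ((‖circleMap 0 1 θ - 0‖ ^ 2 - ‖(q : ℂ) - 0‖ ^ 2) /
      ‖circleMap 0 1 θ - 0 - ((q : ℂ) - 0)‖ ^ 2) • (circleMap 0 1 θ) ^ m) (2 * Real.pi)
  rw [mul_zero, mul_one] at hs
  rw [← hs, smul_smul, inv_mul_cancel₀ (by positivity), one_smul] at h
  rw [← h]
  refine intervalIntegral.integral_congr fun t _ => ?_
  simp only [circleMap, sub_zero, zero_add, Complex.ofReal_one, one_mul, Complex.real_smul]
  have e1 : ‖Complex.exp (((2 * Real.pi * t : ℝ) : ℂ) * Complex.I)‖ = 1 :=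
    Complex.norm_exp_ofReal_mul_I _
  have e2 : ‖Complex.exp (((2 * Real.pi * t : ℝ) : ℂ) * Complex.I) - q‖ ^ 2
      = 1 - 2 * q * Real.cos (2 * Real.pi * t) + q ^ 2 := by
    rw [← Complex.normSq_eq_norm_sq, Complex.normSq_apply, Complex.sub_re, Complex.sub_im,
      Complex.exp_ofReal_mul_I_re, Complex.exp_ofReal_mul_I_im, Complex.ofReal_re,
      Complex.ofReal_im]
    linear_combination Real.sin_sq_add_cos_sq (2 * Real.pi * t)
  rw [e1, e2, ← Complex.exp_nat_mul]
  have e3 : ‖(q : ℂ)‖ ^ 2 = q ^ 2 := by simp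
  rw [e3, poisson]
  congr 2
  · norm_num
  · push_cast; ring

lemma integral_poisson_mul_cos {q : ℝ} (h0 : 0 ≤ q) (h1 : q < 1) (m : ℤ) :
    ∫ t in (0 : ℝ)..1, poisson q t * Real.cos (2 * Real.pi * m * t) = q ^ m.natAbs := by
  have h := congrArg Complex.re (integral_poisson_mul_exp h0 h1 m.natAbs)
  have hi : IntervalIntegrable (fun t : ℝ => (poisson q t : ℂ) *
      Complex.exp ((2 * Real.pi * m.natAbs * t : ℝ) * Complex.I)) volume 0 1 :=
    Continuous.intervalIntegrable (by have := continuous_poisson h0 h1; fun_prop) _ _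
  have h2 := Complex.reCLM.intervalIntegral_comp_comm hi
  rw [Complex.reCLM_apply, h, ← Complex.ofReal_pow, Complex.ofReal_re] at h2
  rw [← h2]
  refine intervalIntegral.integral_congr fun t _ => ?_
  simp only [Complex.reCLM_apply, Complex.re_ofReal_mul, Complex.exp_ofReal_mul_I_re]
  congr 1
  rw [← Int.cast_natCast, Int.natCast_natAbs, Int.cast_abs]
  rcases abs_choice (m : ℝ) with h | h <;> rw [h]
  rw [← Real.cos_neg]; ring_nf

lemma integral_poisson_mul_sin {q : ℝ} (m : ℤ) :
    ∫ t in (0 : ℝ)..1, poisson q t * Real.sin (2 * Real.pi * m * t) = 0 := by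
  set I := ∫ t in (0 : ℝ)..1, poisson q t * Real.sin (2 * Real.pi * m * t) with hI
  have h := intervalIntegral.integral_comp_sub_left (a := 0) (b := 1)
    (fun t => poisson q t * Real.sin (2 * Real.pi * m * t)) 1
  rw [sub_self, sub_zero, ← hI] at h
  have h2 : ∫ t in (0 : ℝ)..1, poisson q (1 - t) * Real.sin (2 * Real.pi * m * (1 - t)) = -I := by
    rw [hI, ← intervalIntegral.integral_neg]
    refine intervalIntegral.integral_congr fun t _ => ?_
    simp only [poisson]
    have e1 : Real.cos (2 * Real.pi * (1 - t)) = Real.cos (2 * Real.pi * t) := by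
      rw [mul_sub, mul_one, Real.cos_two_pi_sub]
    have e2 : Real.sin (2 * Real.pi * m * (1 - t)) = -Real.sin (2 * Real.pi * m * t) := by
      rw [show 2 * Real.pi * m * (1 - t) = m * (2 * Real.pi) - 2 * Real.pi * m * t by ring,
        Real.sin_int_mul_two_pi_sub]
    rw [e1, e2]; ring
  linarith

/-- The kernel with Fourier coefficients `q ^ |m|` for `|m| ≥ n` that changes sign with
`cos (2 π n t)`. -/
def signedKernel (n : ℕ) (q t : ℝ) : ℝ :=
  2 / (q ^ n + (q ^ n)⁻¹) * (Real.cos (2 * Real.pi * n * t) * poisson q t)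

/-- Multiplying by the cosine averages the coefficients at m ± n. For |m| ≥ n the distances |m ± n|
are |m| ± n in some order, so q^{|m|} factors out and the normalisation cancels the rest. -/
lemma integral_signedKernel_mul_exp {n : ℕ} {q : ℝ} (h0 : 0 < q) (h1 : q < 1) {m : ℤ}
    (hm : n ≤ m.natAbs) :
    ∫ t in (0 : ℝ)..1, (signedKernel n q t : ℂ) * Complex.exp (2 * Real.pi * Complex.I * m * t)
      = (q : ℂ) ^ m.natAbs := by
  have hP := continuous_poisson h0.le h1
  have hqn : 0 < q ^ n := by positivity
  have key : ∀ t : ℝ, (signedKernel n q t : ℂ) * Complex.exp (2 * Real.pi * Complex.I * m * t) =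
      ((1 / (q ^ n + (q ^ n)⁻¹) * (poisson q t * Real.cos (2 * Real.pi * (m + n : ℤ) * t)
        + poisson q t * Real.cos (2 * Real.pi * (m - n : ℤ) * t)) : ℝ) : ℂ) +
      ((1 / (q ^ n + (q ^ n)⁻¹) * (poisson q t * Real.sin (2 * Real.pi * (m + n : ℤ) * t)
        + poisson q t * Real.sin (2 * Real.pi * (m - n : ℤ) * t)) : ℝ) : ℂ) * Complex.I := by
    intro t
    have e : (2 * Real.pi * Complex.I * m * t : ℂ) =
        ((2 * Real.pi * m * t : ℝ) : ℂ) * Complex.I := by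
      push_cast; ring
    have a1 : 2 * Real.pi * ((m + n : ℤ) : ℝ) * t = 2 * Real.pi * m * t + 2 * Real.pi * n * t := by
      push_cast; ring
    have a2 : 2 * Real.pi * ((m - n : ℤ) : ℝ) * t = 2 * Real.pi * m * t - 2 * Real.pi * n * t := by
      push_cast; ring
    rw [e, a1, a2, Real.cos_add, Real.cos_sub, Real.sin_add, Real.sin_sub, signedKernel]
    apply Complex.ext
    · rw [Complex.re_ofReal_mul, Complex.exp_ofReal_mul_I_re]
      simp only [Complex.add_re, Complex.ofReal_re, Complex.mul_re, Complex.I_re, Complex.I_im,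
        Complex.ofReal_im]
      ring
    · rw [Complex.im_ofReal_mul, Complex.exp_ofReal_mul_I_im]
      simp only [Complex.add_im, Complex.ofReal_re, Complex.mul_im, Complex.I_re, Complex.I_im,
        Complex.ofReal_im]
      ring
  simp_rw [key]
  rw [intervalIntegral.integral_add, intervalIntegral.integral_mul_const,
    intervalIntegral.integral_ofReal, intervalIntegral.integral_ofReal,
    intervalIntegral.integral_const_mul, intervalIntegral.integral_const_mul,
    intervalIntegral.integral_add, intervalIntegral.integral_add,
    integral_poisson_mul_cos h0.le h1, integral_poisson_mul_cos h0.le h1,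
    integral_poisson_mul_sin, integral_poisson_mul_sin]
  · have : (m + n).natAbs + (m - n).natAbs = 2 * m.natAbs ∧
        ((m + n).natAbs = m.natAbs + n ∧ m.natAbs = (m - n).natAbs + n ∨
        (m - n).natAbs = m.natAbs + n ∧ m.natAbs = (m + n).natAbs + n) := by omega
    have e : q ^ (m + n).natAbs + q ^ (m - n).natAbs = q ^ m.natAbs * (q ^ n + (q ^ n)⁻¹) := by
      rcases this.2 with ⟨h, h'⟩ | ⟨h, h'⟩
      · rw [h]; conv_rhs => rw [h']
        rw [h']; field_simp; ring
      · rw [h]; conv_rhs => rw [h']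
        rw [h']; field_simp; ring
    rw [e]
    have : q ^ n + (q ^ n)⁻¹ ≠ 0 := by positivity
    rw [mul_comm (q ^ m.natAbs), ← mul_assoc, one_div_mul_cancel this]
    simp
  all_goals exact Continuous.intervalIntegrable (by fun_prop) _ _

/-! ### Fourier series of |cos πx| and the L¹ norm of the kernel. -/

lemma hasSum_one_div_four_sq_sub_one :
    HasSum (fun l : ℕ => 1 / (4 * ((l : ℝ) + 1) ^ 2 - 1)) (1 / 2) := by
  rw [hasSum_iff_tendsto_nat_of_nonneg]
  · have h : ∀ N : ℕ, ∑ l ∈ Finset.range N, 1 / (4 * ((l : ℝ) + 1) ^ 2 - 1)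
        = 1 / 2 - 1 / 2 * (1 / (2 * (N : ℝ) + 1)) := by
      intro N
      induction N with
      | zero => norm_num
      | succ N ih =>
        rw [Finset.sum_range_succ, ih]
        have h1 : (2 * (N : ℝ) + 1) ≠ 0 := by positivity
        have h2 : (2 * (N : ℝ) + 3) ≠ 0 := by positivity
        have h3 : 4 * ((N : ℝ) + 1) ^ 2 - 1 = (2 * (N : ℝ) + 1) * (2 * (N : ℝ) + 3) := by ring
        have h4 : 2 * ((N + 1 : ℕ) : ℝ) + 1 = 2 * (N : ℝ) + 3 := by push_cast; ring
        rw [h3, h4]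
        field_simp
        ring
    simp_rw [h]
    have ht : Filter.Tendsto (fun N : ℕ => 1 / (2 * (N : ℝ) + 1)) Filter.atTop (nhds 0) := by
      refine Filter.Tendsto.div_atTop tendsto_const_nhds ?_
      exact Filter.tendsto_atTop_add_const_right _ _
        (tendsto_natCast_atTop_atTop.const_mul_atTop (by norm_num))
    have h2 := (ht.const_mul (1 / 2)).const_sub (1 / 2)
    rwa [mul_zero, sub_zero] at h2
  · intro l
    have : (0 : ℝ) ≤ l := by positivity
    apply one_div_nonneg.2
    nlinarith

/-- Majorant for the coefficients of |cos πx|, up to 2/π. The term l = 0 is set apart because 4l² -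
1 is negative there; each half-line then contributes c/2. -/
lemma hasSum_abs_cos_majorant (c : ℝ) :
    HasSum (fun l : ℤ => if l = 0 then (1 : ℝ) else c / (4 * (l : ℝ) ^ 2 - 1)) (1 + c) := by
  have h := hasSum_one_div_four_sq_sub_one.mul_left c
  obtain ⟨f, hf⟩ : ∃ f : ℤ → ℝ,
      f = fun l : ℤ => if l = 0 then (1 : ℝ) else c / (4 * (l : ℝ) ^ 2 - 1) := ⟨_, rfl⟩
  have h0 : f 0 = 1 := by rw [hf]; exact if_pos rfl
  have h1 : HasSum (fun l : ℕ => f l) (1 + c * (1 / 2)) := by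
    refine (hasSum_nat_add_iff' 1).1 ?_
    rw [Finset.sum_range_one, Nat.cast_zero, h0, add_sub_cancel_left]
    have e : (fun l : ℕ => f ((l + 1 : ℕ) : ℤ)) =
        fun l : ℕ => c * (1 / (4 * ((l : ℝ) + 1) ^ 2 - 1)) := by
      funext l
      rw [hf]
      dsimp only
      rw [if_neg (by omega)]
      push_cast
      ring
    rw [e]
    exact h
  have h2 : HasSum (fun l : ℕ => f (-((l : ℤ) + 1))) (c * (1 / 2)) := by
    have e : (fun l : ℕ => f (-((l : ℤ) + 1))) =
        fun l : ℕ => c * (1 / (4 * ((l : ℝ) + 1) ^ 2 - 1)) := by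
      funext l
      rw [hf]
      dsimp only
      rw [if_neg (by omega)]
      push_cast
      ring
    rw [e]
    exact h
  rw [← hf]
  convert HasSum.of_nat_of_neg_add_one h1 h2 using 1
  ring

/-- The function `|cos (π x)|` on `ℝ / ℤ`. -/
def absCos : C(UnitAddCircle, ℂ) where
  toFun := Function.Periodic.lift (f := fun x : ℝ => ((|Real.cos (Real.pi * x)| : ℝ) : ℂ))
    (c := 1) fun x => by
      simp only [mul_add, mul_one, Real.cos_add_pi, abs_neg]
  continuous_toFun := by
    refine (QuotientAddGroup.isQuotientMap_mk _).continuous_iff.2 ?_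
    change Continuous fun x : ℝ => ((|Real.cos (Real.pi * x)| : ℝ) : ℂ)
    fun_prop

lemma absCos_coe (x : ℝ) : absCos (x : UnitAddCircle) = ((|Real.cos (Real.pi * x)| : ℝ) : ℂ) := rfl

lemma four_sq_sub_one_ne_zero (l : ℤ) : (4 * (l : ℝ) ^ 2 - 1) ≠ 0 := by
  have : (4 * l ^ 2 - 1 : ℤ) ≠ 0 := by
    intro h
    have : (2 * l) * (2 * l) = 1 := by linarith
    rcases Int.mul_eq_one_iff_eq_one_or_neg_one.1 this with h | h <;> omega
  exact_mod_cast this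

lemma fourierCoeff_absCos (l : ℤ) :
    fourierCoeff absCos l =
      ((2 / Real.pi * (-((l.negOnePow : ℤ) : ℝ) / (4 * (l : ℝ) ^ 2 - 1)) : ℝ) : ℂ) := by
  -- On the period starting at -1/2 the cosine is nonnegative, so the absolute value disappears.
  rw [fourierCoeff_eq_intervalIntegral _ _ (-(1 / 2))]
  have hl := four_sq_sub_one_ne_zero l
  have hlC : (4 * (l : ℂ) ^ 2 - 1) ≠ 0 := by exact_mod_cast hl
  have hpi : (Real.pi : ℂ) ≠ 0 := by exact_mod_cast Real.pi_ne_zero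
  let G : ℝ → ℂ := fun x => Complex.exp (-(2 * Real.pi * Complex.I * l) * x) *
    (Complex.sin (Real.pi * x) - 2 * Complex.I * l * Complex.cos (Real.pi * x)) /
      (Real.pi * (1 - 4 * (l : ℂ) ^ 2))
  have hG : ∀ x : ℝ, HasDerivAt G
      (Complex.exp (-(2 * Real.pi * Complex.I * l) * x) * Complex.cos (Real.pi * x)) x := by
    intro x
    have hid : HasDerivAt (fun y : ℝ => (y : ℂ)) 1 x := Complex.ofRealCLM.hasDerivAt
    have he := (hid.const_mul (-(2 * Real.pi * Complex.I * l))).cexp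
    have hs := HasDerivAt.comp x (Complex.hasDerivAt_sin _) (hid.const_mul (Real.pi : ℂ))
    have hc := HasDerivAt.comp x (Complex.hasDerivAt_cos _) (hid.const_mul (Real.pi : ℂ))
    have := (he.mul (hs.sub (hc.const_mul (2 * Complex.I * l)))).div_const
      (Real.pi * (1 - 4 * (l : ℂ) ^ 2))
    refine this.congr_deriv ?_
    have h1 : (1 - 4 * (l : ℂ) ^ 2) ≠ 0 := by
      intro h; apply hlC; linear_combination -h
    rw [div_eq_iff (mul_ne_zero hpi h1)]
    simp only [Pi.sub_apply, Function.comp_apply]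
    linear_combination (4 * Real.pi * (l : ℂ) ^ 2 *
      Complex.exp (-(2 * Real.pi * Complex.I * l) * x) *
      Complex.cos (Real.pi * x)) * Complex.I_sq
  have hint : ∫ x in (-(1 / 2) : ℝ)..(-(1 / 2) + 1),
        fourier (-l) (x : UnitAddCircle) • absCos (x : UnitAddCircle)
      = ∫ x in (-(1 / 2) : ℝ)..(-(1 / 2) + 1),
        Complex.exp (-(2 * Real.pi * Complex.I * l) * x) * Complex.cos (Real.pi * x) := by
    refine intervalIntegral.integral_congr fun x hx => ?_
    rw [Set.uIcc_of_le (by norm_num)] at hx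
    have hcos : 0 ≤ Real.cos (Real.pi * x) := by
      apply Real.cos_nonneg_of_mem_Icc
      constructor <;> nlinarith [hx.1, hx.2, Real.pi_pos]
    simp only [absCos_coe, abs_of_nonneg hcos, fourier_coe_apply, smul_eq_mul]
    push_cast
    congr 2
    ring
  rw [hint, intervalIntegral.integral_eq_sub_of_hasDerivAt (fun x _ => hG x)
    (Continuous.intervalIntegrable (by fun_prop) _ _)]
  have e1 : Complex.exp (-(2 * Real.pi * Complex.I * l) * ((-(1 / 2) + 1 : ℝ) : ℂ))
      = ((l.negOnePow : ℤ) : ℂ) := by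
    rw [show -(2 * Real.pi * Complex.I * l) * ((-(1 / 2) + 1 : ℝ) : ℂ)
      = ((-l : ℤ) : ℂ) * (Real.pi * Complex.I) by push_cast; ring, Complex.exp_int_mul,
      Complex.exp_pi_mul_I, ← Int.negOnePow_neg l, Int.cast_negOnePow]
  have e2 : Complex.exp (-(2 * Real.pi * Complex.I * l) * ((-(1 / 2) : ℝ) : ℂ))
      = ((l.negOnePow : ℤ) : ℂ) := by
    rw [show -(2 * Real.pi * Complex.I * l) * ((-(1 / 2) : ℝ) : ℂ)
      = (l : ℂ) * (Real.pi * Complex.I) by push_cast; ring, Complex.exp_int_mul,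
      Complex.exp_pi_mul_I, Int.cast_negOnePow]
  have c1 : (Real.pi : ℂ) * ((-(1 / 2) + 1 : ℝ) : ℂ) = Real.pi / 2 := by push_cast; ring
  have c2 : (Real.pi : ℂ) * ((-(1 / 2) : ℝ) : ℂ) = -(Real.pi / 2) := by push_cast; ring
  simp only [G]
  rw [e1, e2, c1, c2, Complex.sin_neg, Complex.cos_neg, Complex.sin_pi_div_two,
    Complex.cos_pi_div_two]
  have h1 : (1 - 4 * (l : ℂ) ^ 2) ≠ 0 := by
    intro h; apply hlC; linear_combination -h
  rw [show (1 - 4 * (l : ℂ) ^ 2) = -(4 * (l : ℂ) ^ 2 - 1) by ring]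
  simp only [one_div, inv_one, one_smul]
  push_cast
  field_simp
  ring

lemma norm_fourierCoeff_absCos_le (l : ℤ) :
    ‖fourierCoeff absCos l‖ ≤
      2 / Real.pi * (if l = 0 then (1 : ℝ) else 1 / (4 * (l : ℝ) ^ 2 - 1)) := by
  rw [fourierCoeff_absCos, Complex.norm_real, norm_mul, Real.norm_of_nonneg (by positivity)]
  gcongr
  rw [norm_div, norm_neg]
  have h1 : ‖((l.negOnePow : ℤ) : ℝ)‖ = 1 := by
    rcases Int.even_or_odd l with h | h <;> simp [Int.negOnePow_even, Int.negOnePow_odd, h]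
  rw [h1]
  split_ifs with h
  · subst h; simp
  · rw [Real.norm_of_nonneg]
    have : (1 : ℝ) ≤ (l : ℝ) ^ 2 := by
      have : 1 ≤ l ^ 2 := by have := sq_pos_of_ne_zero h; omega
      exact_mod_cast this
    linarith

lemma summable_norm_fourierCoeff_absCos : Summable fun l => ‖fourierCoeff absCos l‖ :=
  Summable.of_nonneg_of_le (fun _ => norm_nonneg _) norm_fourierCoeff_absCos_le
    ((hasSum_abs_cos_majorant 1).summable.mul_left _)

/-- Integrating the series of |cos| termwise against the Poisson kernel damps the l-th term by
q^{2n|l|}. Bounding this by q^{2n} for l ≠ 0 leaves the telescoping sum of 1/(4l² - 1). -/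
lemma integral_abs_cos_mul_poisson_le {n : ℕ} {q : ℝ} (h0 : 0 < q) (h1 : q < 1) :
    ∫ t in (0 : ℝ)..1, |Real.cos (2 * Real.pi * n * t)| * poisson q t
      ≤ 2 / Real.pi * (1 + (q ^ n) ^ 2) := by
  have hP := continuous_poisson h0.le h1
  have hser : ∀ t : ℝ, HasSum (fun l : ℤ => fourierCoeff absCos l *
      Complex.exp ((2 * Real.pi * (2 * n * l : ℤ) * t : ℝ) * Complex.I) * poisson q t)
      ((|Real.cos (2 * Real.pi * n * t)| * poisson q t : ℝ) : ℂ) := by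
    intro t
    have h := has_pointwise_sum_fourier_series_of_summable (f := absCos)
      (summable_norm_fourierCoeff_absCos.of_norm) ((2 * n * t : ℝ) : UnitAddCircle)
    rw [absCos_coe] at h
    have h2 := h.mul_right (poisson q t : ℂ)
    rw [← Complex.ofReal_mul, show Real.pi * (2 * n * t) = 2 * Real.pi * n * t by ring] at h2
    refine Eq.subst (motive := fun F => HasSum F _) (funext fun l => ?_) h2
    rw [fourier_coe_apply, smul_eq_mul]
    congr 3
    push_cast
    ring
  have hint : HasSum (fun l : ℤ => ∫ t in (0 : ℝ)..1, fourierCoeff absCos l *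
      Complex.exp ((2 * Real.pi * (2 * n * l : ℤ) * t : ℝ) * Complex.I) * poisson q t)
      (∫ t in (0 : ℝ)..1, ((|Real.cos (2 * Real.pi * n * t)| * poisson q t : ℝ) : ℂ)) := by
    refine intervalIntegral.hasSum_integral_of_dominated_convergence
      (fun l t => ‖fourierCoeff absCos l‖ * poisson q t) ?_ ?_ ?_ ?_ ?_
    · intro l
      exact Continuous.aestronglyMeasurable (by fun_prop)
    · intro l
      refine ae_of_all _ fun t _ => ?_
      rw [norm_mul, norm_mul, Complex.norm_exp_ofReal_mul_I, mul_one, Complex.norm_real,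
        Real.norm_of_nonneg (poisson_nonneg h0.le h1 t)]
    · exact ae_of_all _ fun t _ => summable_norm_fourierCoeff_absCos.mul_right _
    · simp_rw [tsum_mul_right]
      exact Continuous.intervalIntegrable (by fun_prop) _ _
    · exact ae_of_all _ fun t _ => hser t
  have hre := Complex.hasSum_re hint
  rw [intervalIntegral.integral_ofReal, Complex.ofReal_re] at hre
  refine hasSum_le (fun l => ?_) hre
    ((hasSum_abs_cos_majorant ((q ^ n) ^ 2)).mul_left (2 / Real.pi))
  have e : ∀ t : ℝ, (fourierCoeff absCos l *
      Complex.exp ((2 * Real.pi * (2 * n * l : ℤ) * t : ℝ) * Complex.I) * poisson q t)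
      = fourierCoeff absCos l *
        (((poisson q t * Real.cos (2 * Real.pi * (2 * n * l : ℤ) * t) : ℝ) : ℂ)
        + ((poisson q t * Real.sin (2 * Real.pi * (2 * n * l : ℤ) * t) : ℝ) : ℂ) * Complex.I) := by
    intro t
    rw [Complex.exp_mul_I, ← Complex.ofReal_cos, ← Complex.ofReal_sin, Complex.ofReal_mul,
      Complex.ofReal_mul]
    ring
  simp_rw [e]
  rw [intervalIntegral.integral_const_mul, intervalIntegral.integral_add,
    intervalIntegral.integral_mul_const, intervalIntegral.integral_ofReal,
    intervalIntegral.integral_ofReal, integral_poisson_mul_cos h0.le h1,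
    integral_poisson_mul_sin]
  · rw [Complex.ofReal_zero, zero_mul, add_zero]
    refine (Complex.re_le_norm _).trans ?_
    rw [norm_mul, Complex.norm_real, Real.norm_of_nonneg (by positivity)]
    refine (mul_le_mul_of_nonneg_right (norm_fourierCoeff_absCos_le l) (by positivity)).trans ?_
    rw [mul_assoc]
    refine mul_le_mul_of_nonneg_left ?_ (by positivity)
    by_cases hl : l = 0
    · simp [hl]
    · rw [if_neg hl, if_neg hl, one_div_mul_eq_div]
      have h2 : (0 : ℝ) < 4 * (l : ℝ) ^ 2 - 1 := by
        have : (1 : ℝ) ≤ (l : ℝ) ^ 2 := by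
          have : 1 ≤ l ^ 2 := by have := sq_pos_of_ne_zero hl; omega
          exact_mod_cast this
        linarith
      refine div_le_div_of_nonneg_right ?_ h2.le
      rw [← pow_mul]
      refine pow_le_pow_of_le_one h0.le h1.le ?_
      rw [Int.natAbs_mul, Int.natAbs_mul]
      have := Int.natAbs_pos.2 hl
      simp only [Int.natAbs_natCast]
      change n * 2 ≤ 2 * n * l.natAbs
      nlinarith
  · exact Continuous.intervalIntegrable (by fun_prop) _ _
  · exact Continuous.intervalIntegrable (by fun_prop) _ _

/-- The factor 1 + q^{2n} cancels exactly against the normalisation 2/(q^n + q^{-n}) = 2q^n/(1 +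
q^{2n}). -/
lemma integral_abs_signedKernel_le {n : ℕ} {q : ℝ} (h0 : 0 < q) (h1 : q < 1) :
    ∫ t in (0 : ℝ)..1, |signedKernel n q t| ≤ 4 / Real.pi * q ^ n := by
  have hp : 0 < q ^ n := by positivity
  have e : ∀ t, |signedKernel n q t| = 2 / (q ^ n + (q ^ n)⁻¹) *
      (|Real.cos (2 * Real.pi * n * t)| * poisson q t) := fun t => by
    rw [signedKernel, abs_mul, abs_mul, abs_of_nonneg (poisson_nonneg h0.le h1 t),
      abs_of_nonneg (a := 2 / _) (by positivity)]
  simp_rw [e]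
  rw [intervalIntegral.integral_const_mul]
  refine (mul_le_mul_of_nonneg_left (integral_abs_cos_mul_poisson_le h0 h1)
    (by positivity)).trans (le_of_eq ?_)
  field_simp
  ring

lemma continuous_signedKernel (n : ℕ) {q : ℝ} (h0 : 0 ≤ q) (h1 : q < 1) :
    Continuous (signedKernel n q) := by
  have := continuous_poisson h0 h1
  unfold signedKernel
  fun_prop

lemma measurable_signedKernel (n : ℕ) :
    Measurable fun p : ℝ × ℝ => signedKernel n (Real.exp (-p.1)) p.2 := by
  unfold signedKernel poisson
  fun_prop

/-! ### Division by powers of |m| through a Laplace integral. -/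

lemma integral_pow_mul_exp_neg_mul (p : ℕ) {r : ℝ} (hr : 0 < r) :
    ∫ u in Set.Ioi (0 : ℝ), u ^ p * Real.exp (-(r * u)) = p.factorial / r ^ (p + 1) := by
  have h := Real.integral_rpow_mul_exp_neg_mul_Ioi (a := p + 1) (by positivity) hr
  rw [Real.Gamma_nat_eq_factorial] at h
  have e : (1 / r) ^ ((p : ℝ) + 1) = 1 / r ^ (p + 1) := by
    rw [← Nat.cast_succ, Real.rpow_natCast, one_div_pow]
  rw [e] at h
  rw [div_eq_mul_one_div, mul_comm, ← h]
  refine setIntegral_congr_fun measurableSet_Ioi fun u _ => ?_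
  simp

lemma integrableOn_pow_mul_exp_neg_mul (p : ℕ) {r : ℝ} (hr : 0 < r) :
    IntegrableOn (fun u : ℝ => u ^ p * Real.exp (-(r * u))) (Set.Ioi 0) := by
  -- A non-integrable function would have integral 0 by convention, while the computed value is
  -- positive.
  by_contra h
  have h1 := integral_pow_mul_exp_neg_mul p hr
  rw [integral_undef h] at h1
  have : (0 : ℝ) < p.factorial / r ^ (p + 1) := by positivity
  linarith

/-- Convolution with `signedKernel n (exp (-u))`. -/
def poissonApprox (n : ℕ) (f : C(UnitAddCircle, ℝ)) (u : ℝ) : C(UnitAddCircle, ℝ) :=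
  ∫ t in Set.Ioc (0 : ℝ) 1,
    signedKernel n (Real.exp (-u)) t • translate ((1 * t : ℝ) : UnitAddCircle) f

lemma stronglyMeasurable_poissonApprox (n : ℕ) (f : C(UnitAddCircle, ℝ)) :
    StronglyMeasurable (poissonApprox n f) := by
  refine StronglyMeasurable.integral_prod_right (f := fun u t : ℝ =>
    signedKernel n (Real.exp (-u)) t • translate ((1 * t : ℝ) : UnitAddCircle) f) ?_
  exact (measurable_signedKernel n).stronglyMeasurable.smul
    ((continuous_translate_coe f 1).comp continuous_snd).stronglyMeasurable

lemma integrableOn_signedKernel (n : ℕ) {u : ℝ} (hu : 0 < u) :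
    IntegrableOn (signedKernel n (Real.exp (-u))) (Set.Ioc 0 1) :=
  ((continuous_signedKernel n (Real.exp_pos _).le (by simpa using hu)).integrableOn_Icc (a := 0)
    (b := 1)).mono_set Set.Ioc_subset_Icc_self

lemma norm_poissonApprox_le {n : ℕ} (f : C(UnitAddCircle, ℝ)) {u : ℝ} (hu : 0 < u) :
    ‖poissonApprox n f u‖ ≤ 4 / Real.pi * Real.exp (-(n * u)) * ‖f‖ := by
  refine (norm_integral_smul_translate_le (integrableOn_signedKernel n hu) 1 f).trans ?_
  rw [← intervalIntegral.integral_of_le zero_le_one]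
  refine mul_le_mul_of_nonneg_right ?_ (norm_nonneg f)
  refine (integral_abs_signedKernel_le (Real.exp_pos _) (by simpa using hu)).trans (le_of_eq ?_)
  rw [← Real.exp_nat_mul]
  ring_nf

lemma coeff_poissonApprox {n : ℕ} (f : C(UnitAddCircle, ℝ)) {u : ℝ} (hu : 0 < u) {m : ℤ}
    (hm : n ≤ m.natAbs) :
    coeff m (poissonApprox n f u) = (Real.exp (-(m.natAbs * u)) : ℂ) * coeff m f := by
  rw [poissonApprox, coeff_integral_smul_translate (integrableOn_signedKernel n hu),
    ← intervalIntegral.integral_of_le zero_le_one]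
  simp only [Complex.ofReal_one, one_mul]
  rw [integral_signedKernel_mul_exp (Real.exp_pos _) (by simpa using hu) hm, ← Complex.ofReal_pow,
    ← Real.exp_nat_mul]
  ring_nf

/-- The Favard-type operator: it acts on Fourier coefficients of order `|m| ≥ n` as division by
`|m| ^ (p + 1)`. -/
def favard (n p : ℕ) (f : C(UnitAddCircle, ℝ)) : C(UnitAddCircle, ℝ) :=
  ∫ u in Set.Ioi (0 : ℝ), (u ^ p / p.factorial : ℝ) • poissonApprox n f u

lemma norm_favard_integrand_le {n : ℕ} (p : ℕ) (f : C(UnitAddCircle, ℝ)) {u : ℝ}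
    (hu : 0 < u) : ‖(u ^ p / p.factorial : ℝ) • poissonApprox n f u‖ ≤
      u ^ p * Real.exp (-(n * u)) * (4 / Real.pi * ‖f‖ / p.factorial) := by
  rw [norm_smul, Real.norm_of_nonneg (by positivity)]
  refine (mul_le_mul_of_nonneg_left (norm_poissonApprox_le f hu) (by positivity)).trans
    (le_of_eq ?_)
  ring

lemma integrableOn_favard_integrand {n : ℕ} (hn : 1 ≤ n) (p : ℕ) (f : C(UnitAddCircle, ℝ)) :
    IntegrableOn (fun u : ℝ => (u ^ p / p.factorial : ℝ) • poissonApprox n f u) (Set.Ioi 0) := by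
  have hn' : (0 : ℝ) < n := by exact_mod_cast hn
  refine Integrable.mono' ((integrableOn_pow_mul_exp_neg_mul p hn').mul_const _) ?_
    ((ae_restrict_iff' measurableSet_Ioi).2 (ae_of_all _ fun u hu =>
      norm_favard_integrand_le p f hu))
  have hw : Continuous fun u : ℝ => (u ^ p / p.factorial : ℝ) := by fun_prop
  exact (hw.stronglyMeasurable.smul
    (stronglyMeasurable_poissonApprox n f)).aestronglyMeasurable

/-- Integrating (4/π)e^{-nu} against u^p/p! gives the constant 4/π, uniformly in p. -/
lemma norm_favard_le {n : ℕ} (hn : 1 ≤ n) (p : ℕ) (f : C(UnitAddCircle, ℝ)) :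
    ‖favard n p f‖ ≤ 4 / Real.pi / (n : ℝ) ^ (p + 1) * ‖f‖ := by
  have hn' : (0 : ℝ) < n := by exact_mod_cast hn
  refine (norm_integral_le_of_norm_le ((integrableOn_pow_mul_exp_neg_mul p hn').mul_const _)
    ((ae_restrict_iff' measurableSet_Ioi).2 (ae_of_all _ fun u hu =>
      norm_favard_integrand_le p f hu))).trans (le_of_eq ?_)
  rw [integral_mul_const, integral_pow_mul_exp_neg_mul p hn']
  have : (p.factorial : ℝ) ≠ 0 := by positivity
  field_simp

/-- On |m| ≥ n each `poissonApprox` has multiplier e^{-u|m|}, whose integral against u^p/p! is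
|m|^{-(p+1)}. -/
lemma coeff_favard {n : ℕ} (hn : 1 ≤ n) (p : ℕ) (f : C(UnitAddCircle, ℝ)) {m : ℤ}
    (hm : n ≤ m.natAbs) :
    coeff m (favard n p f) = ((1 / (m.natAbs : ℝ) ^ (p + 1) : ℝ) : ℂ) * coeff m f := by
  have hm' : (0 : ℝ) < m.natAbs := by exact_mod_cast hn.trans hm
  rw [favard, ← ContinuousLinearMap.integral_comp_comm _ (integrableOn_favard_integrand hn p f)]
  have e : ∫ u in Set.Ioi (0 : ℝ), coeff m ((u ^ p / p.factorial : ℝ) • poissonApprox n f u)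
      = ∫ u in Set.Ioi (0 : ℝ), ((u ^ p * Real.exp (-(m.natAbs * u)) : ℝ) : ℂ) *
        (coeff m f / p.factorial) := by
    refine setIntegral_congr_fun measurableSet_Ioi fun u hu => ?_
    simp only [map_smul, coeff_poissonApprox f hu hm, Complex.real_smul]
    push_cast
    ring
  rw [e, integral_mul_const, integral_complex_ofReal, integral_pow_mul_exp_neg_mul p hm']
  have : (p.factorial : ℂ) ≠ 0 := by exact_mod_cast p.factorial_ne_zero
  push_cast
  field_simp

/-! ### The triangular kernel χ_h² and its cosine transform. -/

lemma chiSq_eq {h : ℝ} (hh : 0 < h) (t : ℝ) : chiSq h t = max 0 (h - |t|) / h ^ 2 := by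
  have e : ∀ s, (ContinuousLinearMap.mul ℝ ℝ) (chi h s) (chi h (t - s)) =
      (Set.Ioo (max (-(h / 2)) (t - h / 2)) (min (h / 2) (t + h / 2))).indicator
        (fun _ => 1 / h ^ 2) s := by
    intro s
    have hmem : t - s ∈ Set.Ioo (-(h / 2)) (h / 2) ↔ s ∈ Set.Ioo (t - h / 2) (t + h / 2) := by
      constructor <;> rintro ⟨h1, h2⟩ <;> constructor <;> linarith
    rw [← Set.Ioo_inter_Ioo, ContinuousLinearMap.mul_apply', chi]
    simp only [Set.indicator_apply, Set.mem_inter_iff, hmem]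
    by_cases h1 : s ∈ Set.Ioo (-(h / 2)) (h / 2) <;>
      by_cases h2 : s ∈ Set.Ioo (t - h / 2) (t + h / 2) <;> simp [h1, h2]
    field_simp
  rw [chiSq, convolution_def]
  simp_rw [e]
  rw [integral_indicator measurableSet_Ioo, setIntegral_const, smul_eq_mul, Real.volume_real_Ioo,
    mul_one_div, max_comm]
  congr 2
  rcases abs_cases t with ⟨h1, h2⟩ | ⟨h1, h2⟩ <;> rw [h1]
  · rw [max_eq_right (by linarith), min_eq_left (by linarith)]; ring
  · rw [max_eq_left (by linarith), min_eq_right (by linarith)]; ring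

lemma continuous_chiSq {h : ℝ} (hh : 0 < h) : Continuous (chiSq h) := by
  rw [funext (chiSq_eq hh)]
  fun_prop

lemma integrable_chiSq {h : ℝ} (hh : 0 < h) : Integrable (chiSq h) := by
  refine (continuous_chiSq hh).integrable_of_hasCompactSupport
    (HasCompactSupport.intro (isCompact_Icc (a := -h) (b := h)) fun t ht => ?_)
  rw [chiSq_eq hh, max_eq_left, zero_div]
  rw [Set.mem_Icc, ← abs_le, not_le] at ht
  linarith

lemma integral_chiSq_mul_of_even {h : ℝ} (hh : 0 < h) {g : ℝ → ℝ} (hg : ∀ t, g |t| = g t) :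
    ∫ t, chiSq h t * g t = 2 / h ^ 2 * ∫ t in (0 : ℝ)..h, (h - t) * g t := by
  have e : ∀ t, chiSq h t * g t = (fun s => max 0 (h - s) / h ^ 2 * g s) |t| := fun t => by
    simp only [hg, chiSq_eq hh]
  refine (integral_congr_ae (ae_of_all _ e)).trans ((integral_comp_abs
    (f := fun s => max 0 (h - s) / h ^ 2 * g s)).trans ?_)
  rw [intervalIntegral.integral_of_le hh.le, ← integral_const_mul,
    ← integral_const_mul, setIntegral_eq_of_subset_of_forall_sdiff_eq_zero measurableSet_Ioi
      (Set.Ioc_subset_Ioi_self : Set.Ioc (0 : ℝ) h ⊆ Set.Ioi 0)]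
  · refine setIntegral_congr_fun measurableSet_Ioc fun t ht => ?_
    rw [max_eq_right (by linarith [ht.2])]
    ring
  · intro t ht
    have : h < t := by
      by_contra hc
      exact ht.2 ⟨ht.1, not_lt.1 hc⟩
    rw [max_eq_left (by linarith)]
    ring

lemma integral_chiSq_mul_cos {h : ℝ} (hh : 0 < h) {β : ℝ} (hβ : β ≠ 0) :
    ∫ t, chiSq h t * Real.cos (β * t) = 2 * (1 - Real.cos (β * h)) / (β * h) ^ 2 := by
  rw [integral_chiSq_mul_of_even hh fun t => by
    rcases abs_choice t with h | h <;> rw [h]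
    rw [mul_neg, Real.cos_neg]]
  have hd : ∀ t ∈ Set.uIcc 0 h, HasDerivAt
      (fun t => (h - t) * Real.sin (β * t) / β - Real.cos (β * t) / β ^ 2)
      ((h - t) * Real.cos (β * t)) t := by
    intro t _
    have hid : HasDerivAt (fun t : ℝ => β * t) (β * 1) t := (hasDerivAt_id t).const_mul β
    have h1 := (((hasDerivAt_id t).const_sub h).mul hid.sin).div_const β
    have h2 := hid.cos.div_const (β ^ 2)
    refine (h1.sub h2).congr_deriv ?_
    simp only [id]
    field_simp
    ring
  rw [intervalIntegral.integral_eq_sub_of_hasDerivAt hd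
    (Continuous.intervalIntegrable (by fun_prop) _ _)]
  simp only [sub_self, mul_zero, Real.sin_zero, Real.cos_zero, zero_mul, zero_div]
  field_simp
  ring

lemma integral_chiSq {h : ℝ} (hh : 0 < h) : ∫ t, chiSq h t = 1 := by
  have e := integral_chiSq_mul_of_even hh (g := fun _ => 1) fun _ => rfl
  simp only [mul_one] at e
  rw [e, intervalIntegral.integral_sub (by simp) (by simp)]
  simp only [intervalIntegral.integral_const, integral_id, smul_eq_mul]
  field_simp
  ring

lemma integral_chiSq_mul_exp {h : ℝ} (hh : 0 < h) (β : ℝ) :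
    ∫ t, (chiSq h t : ℂ) * Complex.exp ((β * t : ℝ) * Complex.I)
      = ((∫ t, chiSq h t * Real.cos (β * t) : ℝ) : ℂ) := by
  have hi := integrable_chiSq hh
  have hc : Integrable fun t => chiSq h t * Real.cos (β * t) :=
    hi.mul_bdd (c := 1) (by fun_prop) (ae_of_all _ fun t => Real.abs_cos_le_one _)
  have hs : Integrable fun t => chiSq h t * Real.sin (β * t) :=
    hi.mul_bdd (c := 1) (by fun_prop) (ae_of_all _ fun t => Real.abs_sin_le_one _)
  have hs0 : ∫ t, chiSq h t * Real.sin (β * t) = 0 := by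
    have h1 := integral_neg_eq_self (fun t => chiSq h t * Real.sin (β * t)) volume
    have h2 : ∀ t, chiSq h (-t) * Real.sin (β * -t) = -(chiSq h t * Real.sin (β * t)) := fun t => by
      rw [chiSq_eq hh, chiSq_eq hh, abs_neg, mul_neg, Real.sin_neg]; ring
    simp_rw [h2] at h1
    rw [integral_neg] at h1
    linarith
  have e : ∀ t, (chiSq h t : ℂ) * Complex.exp ((β * t : ℝ) * Complex.I)
      = ((chiSq h t * Real.cos (β * t) : ℝ) : ℂ)
        + ((chiSq h t * Real.sin (β * t) : ℝ) : ℂ) * Complex.I := fun t => by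
    rw [Complex.exp_mul_I, ← Complex.ofReal_cos, ← Complex.ofReal_sin]
    push_cast
    ring
  simp_rw [e]
  rw [integral_add hc.ofReal (hs.ofReal.mul_const _), integral_mul_const, integral_complex_ofReal,
    integral_complex_ofReal, hs0]
  simp

/-! ### The multiplier of the averaged difference. -/

/-- The coefficients of the difference of order `2k`, divided by the central one. -/
def diffCoeff (k : ℕ) (j : ℤ) : ℝ :=
  (j.negOnePow : ℝ) * ((2 * k).choose ((k : ℤ) + j).toNat : ℝ) / ((2 * k).choose k : ℝ)

/-- `W_{2k}(f, χ_h², ·)` as an element of `C(T)`. -/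
def meanDiff (k : ℕ) (h : ℝ) (f : C(UnitAddCircle, ℝ)) : C(UnitAddCircle, ℝ) :=
  ∑ j ∈ Finset.Icc (-(k : ℤ)) (k : ℤ), diffCoeff k j •
    ∫ t : ℝ, chiSq h t • translate ((j * t : ℝ) : UnitAddCircle) f

lemma meanDiff_apply {h : ℝ} (hh : 0 < h) (k : ℕ) (f : C(UnitAddCircle, ℝ)) (x : UnitAddCircle) :
    meanDiff k h f x = W k f (chiSq h) x := by
  have hi := fun j : ℤ => integrable_smul_translate (integrable_chiSq hh) (j : ℝ) f
  have e : ∀ j : ℤ, (∫ t : ℝ, chiSq h t • translate ((j * t : ℝ) : UnitAddCircle) f) x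
      = ∫ t : ℝ, chiSq h t * f (x + ((j * t : ℝ) : UnitAddCircle)) := fun j =>
    ((ContinuousMap.evalCLM ℝ x).integral_comp_comm (hi j)).symm
  have hi2 : ∀ j : ℤ, Integrable fun t : ℝ => chiSq h t * f (x + ((j * t : ℝ) : UnitAddCircle)) :=
    fun j => (ContinuousMap.evalCLM ℝ x).integrable_comp (hi j)
  rw [W]
  simp only [symmDiff, Finset.sum_mul]
  rw [integral_finsetSum]
  · rw [meanDiff, ContinuousMap.sum_apply, Finset.mul_sum]
    refine Finset.sum_congr rfl fun j _ => ?_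
    rw [ContinuousMap.smul_apply, e j, smul_eq_mul, diffCoeff, div_mul_eq_mul_div, div_eq_inv_mul,
      ← integral_const_mul]
    congr 2
    ext t
    ring
  · intro j _
    refine ((hi2 j).const_mul ((j.negOnePow : ℝ) * ((2 * k).choose ((k : ℤ) + j).toNat : ℝ))).congr
      (ae_of_all _ fun t => ?_)
    ring

/-- The Fourier multiplier of `meanDiff`. -/
def meanDiffSymbol (k : ℕ) (h : ℝ) (m : ℤ) : ℝ :=
  ∑ j ∈ Finset.Icc (-(k : ℤ)) (k : ℤ), diffCoeff k j *
    ∫ t : ℝ, chiSq h t * Real.cos (2 * Real.pi * m * j * t)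

lemma coeff_meanDiff {h : ℝ} (hh : 0 < h) (k : ℕ) (f : C(UnitAddCircle, ℝ)) (m : ℤ) :
    coeff m (meanDiff k h f) = meanDiffSymbol k h m * coeff m f := by
  rw [meanDiff, map_sum, meanDiffSymbol, Complex.ofReal_sum, Finset.sum_mul]
  refine Finset.sum_congr rfl fun j _ => ?_
  rw [map_smul, coeff_integral_smul_translate (integrable_chiSq hh), Complex.ofReal_mul,
    ← integral_chiSq_mul_exp hh, Complex.real_smul, mul_assoc (diffCoeff k j : ℂ)]
  congr 2
  refine integral_congr_ae (ae_of_all _ fun t => ?_)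
  push_cast
  ring_nf

lemma sum_Icc_neg_of_even {g : ℤ → ℝ} (hg : ∀ j, g (-j) = g j) (k : ℕ) :
    ∑ j ∈ Finset.Icc (-(k : ℤ)) (k : ℤ), g j = g 0 + 2 * ∑ j ∈ Finset.Icc 1 k, g j := by
  induction k with
  | zero => simp
  | succ k ih =>
    have e : Finset.Icc (-((k + 1 : ℕ) : ℤ)) ((k + 1 : ℕ) : ℤ) =
        insert (-((k + 1 : ℕ) : ℤ)) (insert ((k + 1 : ℕ) : ℤ) (Finset.Icc (-(k : ℤ)) (k : ℤ))) := by
      ext j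
      simp only [Finset.mem_insert, Finset.mem_Icc]
      omega
    rw [e, Finset.sum_insert (by simp only [Finset.mem_insert, Finset.mem_Icc]; omega),
      Finset.sum_insert (by simp only [Finset.mem_Icc]; omega), ih, hg,
      Finset.sum_Icc_succ_top (by omega)]
    ring

lemma diffCoeff_natCast (k j : ℕ) : diffCoeff k j = (-1) ^ j * coeffA k j := by
  rw [diffCoeff, coeffA, Int.cast_negOnePow_natCast ℝ, mul_div_assoc]
  norm_cast

lemma diffCoeff_neg {k : ℕ} {j : ℤ} (hj : j.natAbs ≤ k) : diffCoeff k (-j) = diffCoeff k j := by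
  rw [diffCoeff, diffCoeff, Int.negOnePow_neg]
  have h1 : ((k : ℤ) + -j).toNat ≤ 2 * k := by omega
  rw [← Nat.choose_symm h1]
  congr 4
  omega

lemma meanDiffSymbol_eq {h : ℝ} (k : ℕ) (m : ℤ) :
    meanDiffSymbol k h m = (∫ t : ℝ, chiSq h t) +
      2 * ∑ j ∈ Finset.Icc 1 k, (-1) ^ j * coeffA k j *
        ∫ t : ℝ, chiSq h t * Real.cos (2 * Real.pi * m * j * t) := by
  let g : ℤ → ℝ := fun j => diffCoeff k j.natAbs *
    ∫ t : ℝ, chiSq h t * Real.cos (2 * Real.pi * m * j * t)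
  have hg : ∀ j, g (-j) = g j := fun j => by
    simp only [g, Int.natAbs_neg]
    congr 2
    ext t
    rw [← Real.cos_neg]
    push_cast
    ring_nf
  have e := sum_Icc_neg_of_even hg k
  have hc : ((2 * k).choose k : ℝ) ≠ 0 := by
    exact_mod_cast (Nat.choose_pos (by omega)).ne'
  have h0 : g 0 = ∫ t : ℝ, chiSq h t := by
    simp [g, diffCoeff, hc]
  rw [h0] at e
  rw [meanDiffSymbol, ← Finset.sum_congr rfl (fun j hj => ?_), e]
  · congr 2
    refine Finset.sum_congr rfl fun j _ => ?_
    simp only [g, Int.natAbs_natCast, diffCoeff_natCast, Int.cast_natCast]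
  · rw [Finset.mem_Icc] at hj
    simp only [g]
    congr 1
    rcases Int.natAbs_eq j with h | h
    · rw [← h]
    · conv_rhs => rw [h]
      rw [diffCoeff_neg (by omega)]

/-! ### The difference operator in the symbol, and its norm. -/

lemma coeffA_nonneg (k j : ℕ) : 0 ≤ coeffA k j := by unfold coeffA; positivity

lemma coeffA_succ_le (k j : ℕ) : coeffA k (j + 1) ≤ coeffA k j := by
  unfold coeffA
  refine div_le_div_of_nonneg_right ?_ (Nat.cast_nonneg _)
  have h := Nat.choose_succ_right_eq (2 * k) (k + j)
  have h2 : (2 * k).choose (k + j) * (2 * k - (k + j)) ≤ (2 * k).choose (k + j) * (k + j + 1) :=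
    Nat.mul_le_mul_left _ (by omega)
  rw [← h] at h2
  exact_mod_cast Nat.le_of_mul_le_mul_right h2 (by omega)

/-- Consecutive terms pair off; the induction peels the first two terms and shifts the sequence. -/
lemma alternating_sum_nonneg (N : ℕ) : ∀ b : ℕ → ℝ, Antitone b → (∀ j, 0 ≤ b j) →
    0 ≤ ∑ j ∈ Finset.range N, (-1) ^ j * b j := by
  induction N using Nat.twoStepInduction with
  | zero => intro b _ _; simp
  | one => intro b _ hb; simpa using hb 0
  | more N ih _ =>
    intro b hb hb0
    rw [Finset.sum_range_succ', Finset.sum_range_succ']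
    have h := ih (fun j => b (j + 2)) (fun i j hij => hb (by omega)) fun j => hb0 _
    have e : ∀ j ∈ Finset.range N, (-1 : ℝ) ^ (j + 1 + 1) * b (j + 1 + 1) = (-1) ^ j * b (j + 2) :=
      fun j _ => by rw [pow_succ, pow_succ]; ring
    rw [Finset.sum_congr rfl e]
    have := hb (show 0 ≤ 1 by omega)
    simp only [pow_zero, zero_add, pow_one]
    linarith

lemma mu_sq (k : ℕ) : mu k ^ 2 =
    8 / Real.pi ^ 2 * ∑ j ∈ (Finset.Icc 1 k).filter Odd, coeffA k j / (j : ℝ) ^ 2 := by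
  rw [mu, Real.sq_sqrt]
  exact mul_nonneg (by positivity) (Finset.sum_nonneg fun j _ =>
    div_nonneg (coeffA_nonneg k j) (by positivity))

/-- Even j cancel and odd j double, which is how μ² arises. -/
lemma sum_odd_coeffA (k : ℕ) :
    (∑ j ∈ Finset.Icc 1 k, (-1) ^ (j + 1) * (coeffA k j / (j : ℝ) ^ 2))
      + ∑ j ∈ Finset.Icc 1 k, coeffA k j / (j : ℝ) ^ 2 = Real.pi ^ 2 / 4 * mu k ^ 2 := by
  rw [mu_sq, ← Finset.sum_add_distrib, Finset.sum_filter, Finset.mul_sum, Finset.mul_sum]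
  refine Finset.sum_congr rfl fun j _ => ?_
  have := Real.pi_ne_zero
  split_ifs with h
  · rw [(Odd.add_one h).neg_one_pow]
    field_simp
    ring
  · rw [(Nat.not_odd_iff_even.1 h).add_one.neg_one_pow]
    ring

lemma alternating_sum_coeffA_nonneg (k : ℕ) :
    0 ≤ ∑ j ∈ Finset.Icc 1 k, (-1) ^ (j + 1) * (coeffA k j / (j : ℝ) ^ 2) := by
  have h := alternating_sum_nonneg k (fun j => coeffA k (j + 1) / ((j + 1 : ℕ) : ℝ) ^ 2)
    (antitone_nat_of_succ_le fun j => by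
      have := coeffA_nonneg k (j + 1)
      have := coeffA_succ_le k (j + 1)
      gcongr
      omega)
    fun j => div_nonneg (coeffA_nonneg k _) (by positivity)
  have e := Finset.sum_Ico_add' (fun j : ℕ => (-1 : ℝ) ^ (j + 1) * (coeffA k j / (j : ℝ) ^ 2)) 0 k 1
  have hI : Finset.Icc 1 k = Finset.Ico (0 + 1) (k + 1) := by
    ext j
    simp only [Finset.mem_Icc, Finset.mem_Ico]
    omega
  rw [hI, ← e, ← Finset.range_eq_Ico]
  convert h using 2
  rw [pow_succ, pow_succ]
  ring

/-- The coefficient of x is a nonnegative alternating sum, so its absolute value costs nothing; the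
y_j are bounded termwise. Stated for a general normed space, to serve both for the operator on
`C(T)` and for its scalar symbol. -/
lemma norm_alternating_sum_smul_sub_le {V : Type*} [NormedAddCommGroup V] [NormedSpace ℝ V]
    (k : ℕ) {C : ℝ} {x : V} {y : ℕ → V} (hx : ‖x‖ ≤ C) (hy : ∀ j, ‖y j‖ ≤ C) :
    ‖∑ j ∈ Finset.Icc 1 k, ((-1) ^ (j + 1) * (coeffA k j / (j : ℝ) ^ 2)) • (x - y j)‖
      ≤ Real.pi ^ 2 / 4 * mu k ^ 2 * C := by
  rw [← sum_odd_coeffA, add_mul, Finset.sum_mul _ (fun j : ℕ => coeffA k j / (j : ℝ) ^ 2)]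
  simp_rw [smul_sub]
  rw [Finset.sum_sub_distrib, ← Finset.sum_smul]
  refine (norm_sub_le _ _).trans (add_le_add ?_ ?_)
  · rw [norm_smul, Real.norm_of_nonneg (alternating_sum_coeffA_nonneg k)]
    exact mul_le_mul_of_nonneg_left hx (alternating_sum_coeffA_nonneg k)
  · refine norm_sum_le_of_le _ fun j _ => ?_
    have h0 : 0 ≤ coeffA k j / (j : ℝ) ^ 2 := div_nonneg (coeffA_nonneg k j) (by positivity)
    rw [norm_smul, norm_mul, norm_pow, norm_neg, norm_one, one_pow, one_mul, Real.norm_of_nonneg h0]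
    exact mul_le_mul_of_nonneg_left (hy j) h0

/-- The difference operator whose multiplier is `m² (1 - w(m))`, where `w` is the multiplier of
`meanDiff k (1 / (2 n))`. -/
def diffOp (n k : ℕ) (f : C(UnitAddCircle, ℝ)) : C(UnitAddCircle, ℝ) :=
  (4 * (n : ℝ) ^ 2 / Real.pi ^ 2) •
    ∑ j ∈ Finset.Icc 1 k, ((-1) ^ (j + 1) * (coeffA k j / (j : ℝ) ^ 2)) •
      (f - (1 / 2 : ℝ) • (translate ((j / (2 * n) : ℝ) : UnitAddCircle) f
          + translate ((-(j / (2 * n)) : ℝ) : UnitAddCircle) f))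

/-- The Fourier multiplier of `diffOp`. -/
def diffSymbol (n k : ℕ) (m : ℤ) : ℝ :=
  (4 * (n : ℝ) ^ 2 / Real.pi ^ 2) *
    ∑ j ∈ Finset.Icc 1 k, ((-1) ^ (j + 1) * (coeffA k j / (j : ℝ) ^ 2)) *
      (1 - Real.cos (Real.pi * m * j / n))

lemma coeff_diffOp (n k : ℕ) (f : C(UnitAddCircle, ℝ)) (m : ℤ) :
    coeff m (diffOp n k f) = diffSymbol n k m * coeff m f := by
  simp only [diffOp, diffSymbol, map_smul, map_sum, map_sub, map_add, Complex.real_smul,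
    Complex.ofReal_mul, Complex.ofReal_sum,
    coeff_translate, fourier_coe_apply]
  rw [mul_assoc ((4 * (n : ℝ) ^ 2 / Real.pi ^ 2 : ℝ) : ℂ), Finset.sum_mul]
  congr 1
  refine Finset.sum_congr rfl fun j _ => ?_
  rw [mul_assoc (((-1 : ℝ) ^ (j + 1) : ℝ) * ((coeffA k j / (j : ℝ) ^ 2 : ℝ) : ℂ))]
  congr 1
  have e1 : (2 * Real.pi * Complex.I * m * ((j / (2 * n) : ℝ) : ℂ) / ((1 : ℝ) : ℂ) : ℂ)
      = ((Real.pi * m * j / n : ℝ) : ℂ) * Complex.I := by push_cast; ring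
  have e2 : (2 * Real.pi * Complex.I * m * ((-(j / (2 * n)) : ℝ) : ℂ) / ((1 : ℝ) : ℂ) : ℂ)
      = -((Real.pi * m * j / n : ℝ) : ℂ) * Complex.I := by push_cast; ring
  rw [e1, e2, Complex.ofReal_sub, Complex.ofReal_cos, Complex.cos, Complex.ofReal_one]
  push_cast
  ring

lemma coeff_diffOp_iterate (n k s : ℕ) (f : C(UnitAddCircle, ℝ)) (m : ℤ) :
    coeff m ((diffOp n k)^[s] f) = (diffSymbol n k m : ℂ) ^ s * coeff m f := by
  induction s with
  | zero => simp
  | succ s ih =>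
    rw [Function.iterate_succ_apply', coeff_diffOp, ih]
    ring

lemma norm_diffOp_le (n k : ℕ) (f : C(UnitAddCircle, ℝ)) :
    ‖diffOp n k f‖ ≤ (n : ℝ) ^ 2 * mu k ^ 2 * ‖f‖ := by
  rw [diffOp, norm_smul, Real.norm_of_nonneg (by positivity)]
  refine (mul_le_mul_of_nonneg_left (norm_alternating_sum_smul_sub_le k
    (C := ‖f‖) le_rfl fun j => ?_) (by positivity)).trans (le_of_eq ?_)
  · rw [norm_smul, Real.norm_of_nonneg (by norm_num)]
    have := norm_add_le (translate ((j / (2 * n) : ℝ) : UnitAddCircle) f)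
      (translate ((-(j / (2 * n)) : ℝ) : UnitAddCircle) f)
    have h1 := norm_translate_apply_le ((j / (2 * n) : ℝ) : UnitAddCircle) f
    have h2 := norm_translate_apply_le ((-(j / (2 * n)) : ℝ) : UnitAddCircle) f
    linarith
  · have := Real.pi_ne_zero
    field_simp

lemma norm_diffOp_iterate_le (n k s : ℕ) (f : C(UnitAddCircle, ℝ)) :
    ‖(diffOp n k)^[s] f‖ ≤ ((n : ℝ) ^ 2 * mu k ^ 2) ^ s * ‖f‖ := by
  induction s with
  | zero => simp
  | succ s ih =>
    rw [Function.iterate_succ_apply']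
    refine (norm_diffOp_le n k _).trans ((mul_le_mul_of_nonneg_left ih (by positivity)).trans
      (le_of_eq ?_))
    ring

lemma abs_diffSymbol_le (n k : ℕ) (m : ℤ) : |diffSymbol n k m| ≤ (n : ℝ) ^ 2 * mu k ^ 2 := by
  rw [diffSymbol, abs_mul, abs_of_nonneg (by positivity)]
  have h := norm_alternating_sum_smul_sub_le k (C := 1) (x := (1 : ℝ))
    (y := fun j => Real.cos (Real.pi * m * j / n)) (by simp) fun j => Real.abs_cos_le_one _
  simp only [smul_eq_mul, Real.norm_eq_abs] at h
  refine (mul_le_mul_of_nonneg_left h (by positivity)).trans (le_of_eq ?_)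
  have := Real.pi_ne_zero
  field_simp

/-- The choice h = 1/(2n) turns 2πmjh into πmj/n, and the transform 2(1 - cos βh)/(βh)² supplies
both the weights 1/j² and the factor 1/m². -/
lemma meanDiffSymbol_eq_one_sub {n : ℕ} (hn : 1 ≤ n) (k : ℕ) {m : ℤ} (hm : m ≠ 0) :
    meanDiffSymbol k (1 / (2 * (n : ℝ))) m = 1 - diffSymbol n k m / (m : ℝ) ^ 2 := by
  have hn' : (0 : ℝ) < n := by exact_mod_cast hn
  have hm' : (m : ℝ) ≠ 0 := by exact_mod_cast hm
  have hh : 0 < 1 / (2 * (n : ℝ)) := by positivity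
  rw [meanDiffSymbol_eq, integral_chiSq hh, diffSymbol, sub_eq_add_neg, Finset.mul_sum,
    Finset.mul_sum, Finset.sum_div, ← Finset.sum_neg_distrib]
  congr 1
  refine Finset.sum_congr rfl fun j hj => ?_
  have hj' : (0 : ℝ) < j := by
    have := (Finset.mem_Icc.1 hj).1
    exact_mod_cast this
  have hpi := Real.pi_ne_zero
  rw [integral_chiSq_mul_cos hh (by positivity : 2 * Real.pi * (m : ℝ) * j ≠ 0),
    show 2 * Real.pi * (m : ℝ) * j * (1 / (2 * (n : ℝ))) = Real.pi * m * j / n by field_simp,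
    pow_succ]
  field_simp
  ring

/-- At m = n the cosines are (-1)^j, so the bound of `abs_diffSymbol_le` is attained. -/
lemma diffSymbol_self {n : ℕ} (hn : 1 ≤ n) (k : ℕ) :
    diffSymbol n k n = (n : ℝ) ^ 2 * mu k ^ 2 := by
  have hn' : (n : ℝ) ≠ 0 := by exact_mod_cast (by omega : n ≠ 0)
  have hpi := Real.pi_ne_zero
  have h := sum_odd_coeffA k
  rw [← Finset.sum_add_distrib] at h
  have e : ∀ j ∈ Finset.Icc 1 k, ((-1 : ℝ) ^ (j + 1) * (coeffA k j / (j : ℝ) ^ 2)) *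
      (1 - Real.cos (Real.pi * (n : ℤ) * j / n)) =
      (-1) ^ (j + 1) * (coeffA k j / (j : ℝ) ^ 2) + coeffA k j / (j : ℝ) ^ 2 := fun j _ => by
    rw [Int.cast_natCast, show Real.pi * (n : ℝ) * j / n = j * Real.pi by field_simp,
      Real.cos_nat_mul_pi, pow_succ]
    have : ((-1 : ℝ) ^ j) * (-1) ^ j = 1 := by rw [← mul_pow]; simp
    linear_combination (coeffA k j / (j : ℝ) ^ 2) * this
  rw [diffSymbol, Finset.sum_congr rfl e, h]
  field_simp

lemma meanDiffSymbol_self {n : ℕ} (hn : 1 ≤ n) (k : ℕ) :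
    meanDiffSymbol k (1 / (2 * (n : ℝ))) n = 1 - mu k ^ 2 := by
  have hn' : (n : ℝ) ≠ 0 := by exact_mod_cast (by omega : n ≠ 0)
  rw [meanDiffSymbol_eq_one_sub hn k (by omega), diffSymbol_self hn]
  push_cast
  field_simp

/-! ### Inversion of the multiplier by a Neumann series. -/

/-- The terms of the Neumann series for the inverse of `meanDiff k (1 / (2 n))` on the frequencies
of order at least `n`. -/
def neumannTerm (n k : ℕ) (g : C(UnitAddCircle, ℝ)) : ℕ → C(UnitAddCircle, ℝ)
  | 0 => g
  | s + 1 => (diffOp n k)^[s + 1] (favard n (2 * s + 1) g)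

/-- The factor n^{2s} from s applications of `diffOp` cancels the n^{-2s} from one `favard` of order
p + 1 = 2s. -/
lemma norm_neumannTerm_le {n : ℕ} (hn : 1 ≤ n) (k : ℕ) (g : C(UnitAddCircle, ℝ)) (s : ℕ) :
    ‖neumannTerm n k g s‖ ≤ (mu k ^ 2) ^ s * (4 / Real.pi * ‖g‖) := by
  have hn' : (0 : ℝ) < n := by exact_mod_cast hn
  cases s with
  | zero =>
    rw [pow_zero, one_mul]
    -- The zeroth term involves no division by m², so its constant is 1, which is at most 4/π.
    refine le_mul_of_one_le_left (norm_nonneg g) ?_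
    rw [one_le_div Real.pi_pos]
    exact Real.pi_le_four
  | succ s =>
    refine (norm_diffOp_iterate_le n k (s + 1) _).trans ?_
    refine (mul_le_mul_of_nonneg_left (norm_favard_le hn (2 * s + 1) g) (by positivity)).trans
      (le_of_eq ?_)
    rw [mul_pow, ← pow_mul, show 2 * (s + 1) = 2 * s + 1 + 1 by ring]
    field_simp

lemma coeff_neumannTerm {n : ℕ} (hn : 1 ≤ n) (k : ℕ) (g : C(UnitAddCircle, ℝ)) {m : ℤ}
    (hm : n ≤ m.natAbs) (s : ℕ) :
    coeff m (neumannTerm n k g s) =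
      ((diffSymbol n k m / (m : ℝ) ^ 2 : ℝ) : ℂ) ^ s * coeff m g := by
  have hm1 : (0 : ℝ) < m.natAbs := by exact_mod_cast hn.trans hm
  have hmsq : (m : ℝ) ^ 2 = (m.natAbs : ℝ) ^ 2 := by
    rw [← Int.cast_natCast, Int.natCast_natAbs, Int.cast_abs, sq_abs]
  cases s with
  | zero => simp [neumannTerm]
  | succ s =>
    rw [neumannTerm, coeff_diffOp_iterate, coeff_favard hn _ _ hm, hmsq, ← mul_assoc]
    congr 1
    rw [← Complex.ofReal_pow, ← Complex.ofReal_pow, ← Complex.ofReal_mul, div_pow, ← pow_mul,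
      show 2 * (s + 1) = 2 * s + 1 + 1 by ring, mul_one_div]

lemma hasSum_geometric_mul {d : ℝ} (hd : |d| < 1) (z : ℂ) :
    HasSum (fun s : ℕ => (d : ℂ) ^ s * z) ((1 - (d : ℂ))⁻¹ * z) := by
  have h : ‖(d : ℂ)‖ < 1 := by rwa [Complex.norm_real]
  exact (hasSum_geometric_of_norm_lt_one h).mul_right z

/-- The upper estimate, with the Fourier multiplier inverted by a Neumann series. -/
theorem bestApprox_le_norm_meanDiff {n k : ℕ} (hn : 1 ≤ n) (hmu : mu k ^ 2 < 1)
    (f : C(UnitAddCircle, ℝ)) :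
    bestApprox n f ≤ 4 / Real.pi / (1 - mu k ^ 2) * ‖meanDiff k (1 / (2 * (n : ℝ))) f‖ := by
  have hn' : (0 : ℝ) < n := by exact_mod_cast hn
  have hh : 0 < 1 / (2 * (n : ℝ)) := by positivity
  obtain ⟨g, hg⟩ : ∃ g, g = meanDiff k (1 / (2 * (n : ℝ))) f := ⟨_, rfl⟩
  rw [← hg]
  have hx := norm_neumannTerm_le hn k g
  have hgeo := (hasSum_geometric_of_lt_one (sq_nonneg (mu k)) hmu).mul_right (4 / Real.pi * ‖g‖)
  have hsum : Summable (neumannTerm n k g) := Summable.of_norm_bounded hgeo.summable hx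
  have hnorm := tsum_of_norm_bounded hgeo hx
  refine (bestApprox_le (g := ∑' s, neumannTerm n k g s) fun m hm => ?_).trans
    (hnorm.trans (le_of_eq ?_))
  · have hm1 : (0 : ℝ) < m.natAbs := by exact_mod_cast hn.trans hm
    have hm0 : m ≠ 0 := by omega
    have hmsq : (m : ℝ) ^ 2 = (m.natAbs : ℝ) ^ 2 := by
      rw [← Int.cast_natCast, Int.natCast_natAbs, Int.cast_abs, sq_abs]
    have hgc : coeff m g = ((1 - diffSymbol n k m / (m : ℝ) ^ 2 : ℝ) : ℂ) * coeff m f := by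
      rw [hg, coeff_meanDiff hh, meanDiffSymbol_eq_one_sub hn k hm0]
    -- For |m| ≥ n the symbol bound n²μ² divided by m² is at most μ².
    have hd1 : |diffSymbol n k m / (m : ℝ) ^ 2| < 1 := by
      refine lt_of_le_of_lt ?_ hmu
      rw [abs_div, hmsq, abs_of_nonneg (sq_nonneg (m.natAbs : ℝ)), div_le_iff₀ (by positivity)]
      refine (abs_diffSymbol_le n k m).trans ?_
      rw [mul_comm]
      have : (n : ℝ) ≤ m.natAbs := by exact_mod_cast hm
      gcongr
    -- The series converges in `C(T)`, so its coefficients are scalar geometric series with sum (1 -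
    -- d)⁻¹ times that of g, which is the coefficient of f.
    have h1 := hsum.hasSum.mapL (coeff m)
    simp only [coeff_neumannTerm hn k g hm] at h1
    generalize diffSymbol n k m / (m : ℝ) ^ 2 = d at *
    have h2 := hasSum_geometric_mul hd1 (coeff m g)
    rw [h1.unique h2, hgc]
    have h3 : ((1 - d : ℝ) : ℂ) ≠ 0 := by
      rw [Complex.ofReal_ne_zero]
      linarith [(abs_lt.1 hd1).2]
    rw [Complex.ofReal_sub, Complex.ofReal_one] at h3 ⊢
    rw [inv_mul_cancel_left₀ h3]
  · rw [inv_mul_eq_div]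
    ring

/-! ### The test function cos 2πnx and the lower bound. -/

/-- The function `cos (2 π n x)` in `C(T)`. -/
def cosFun (n : ℕ) : C(UnitAddCircle, ℝ) := ⟨fun x => (fourier (n : ℤ) x).re, by fun_prop⟩

lemma cosFun_coe (n : ℕ) (x : ℝ) :
    cosFun n (x : UnitAddCircle) = Real.cos (2 * Real.pi * n * x) := by
  change (fourier (n : ℤ) (x : UnitAddCircle)).re = _
  rw [fourier_coe_apply, show (2 * Real.pi * Complex.I * (n : ℤ) * x / (1 : ℝ) : ℂ)
    = ((2 * Real.pi * n * x : ℝ) : ℂ) * Complex.I by push_cast; ring, Complex.exp_ofReal_mul_I_re]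

lemma norm_cosFun_le (n : ℕ) : ‖cosFun n‖ ≤ 1 := by
  refine (ContinuousMap.norm_le _ zero_le_one).2 fun x => ?_
  induction x using QuotientAddGroup.induction_on with
  | H x => rw [cosFun_coe]; exact Real.abs_cos_le_one _

lemma coeff_cosFun_of_ne {n : ℕ} {m : ℤ} (hm : m.natAbs ≠ n) : coeff m (cosFun n) = 0 := by
  have hi : ∀ l : ℤ, Integrable (fun x => fourier (T := (1 : ℝ)) l x) AddCircle.haarAddCircle :=
    fun l => Continuous.integrable_of_hasCompactSupport (by fun_prop)
      (HasCompactSupport.of_compactSpace _)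
  have e : (fun x => ((cosFun n x : ℝ) : ℂ)) =
      (1 / 2 : ℂ) • ((fun x => fourier (T := (1 : ℝ)) (n : ℤ) x)
        + fun x => fourier (T := (1 : ℝ)) (-(n : ℤ)) x) := by
    funext x
    simp only [Pi.smul_apply, Pi.add_apply, fourier_neg, Complex.add_conj, smul_eq_mul]
    change (((fourier (n : ℤ) x).re : ℝ) : ℂ) = _
    push_cast
    ring
  change fourierCoeff (fun x => ((cosFun n x : ℝ) : ℂ)) m = 0
  rw [e]
  have h1 := congrFun (fourierCoeff_fourier (T := 1) (n : ℤ)) m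
  have h2 := congrFun (fourierCoeff_fourier (T := 1) (-(n : ℤ))) m
  rw [Pi.single_eq_of_ne (by omega)] at h1 h2
  rw [fourierCoeff.const_smul, fourierCoeff.add (hi _) (hi _), Pi.add_apply, h1, h2]
  simp

lemma meanDiffSymbol_neg (k : ℕ) (h : ℝ) (m : ℤ) :
    meanDiffSymbol k h (-m) = meanDiffSymbol k h m := by
  unfold meanDiffSymbol
  refine Finset.sum_congr rfl fun j _ => ?_
  congr 2
  ext t
  rw [← Real.cos_neg]
  push_cast
  ring_nf

/-- With n = 0 the polynomial criterion leaves only an empty sum, hence f - g = 0. -/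
lemma eq_of_coeff_eq {f g : C(UnitAddCircle, ℝ)} (h : ∀ m, coeff m f = coeff m g) : f = g := by
  obtain ⟨a, b, hp⟩ := mem_trigPoly_of_coeff_eq_zero (n := 0) (f := f - g) fun m _ => by
    rw [map_sub, h m, sub_self]
  ext x
  induction x using QuotientAddGroup.induction_on with
  | H x =>
    have := hp x
    rw [Finset.range_zero, Finset.sum_empty] at this
    exact sub_eq_zero.1 this

lemma meanDiff_cosFun {n : ℕ} (hn : 1 ≤ n) (k : ℕ) :
    meanDiff k (1 / (2 * (n : ℝ))) (cosFun n) = (1 - mu k ^ 2) • cosFun n := by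
  have hh : 0 < 1 / (2 * (n : ℝ)) := by
    have : (0 : ℝ) < n := by exact_mod_cast hn
    positivity
  refine eq_of_coeff_eq fun m => ?_
  rw [coeff_meanDiff hh, map_smul, Complex.real_smul]
  by_cases hm : m.natAbs = n
  · rw [← meanDiffSymbol_self hn]
    rcases Int.natAbs_eq m with h | h <;> rw [h, hm]
    rw [meanDiffSymbol_neg]
  · rw [coeff_cosFun_of_ne hm, mul_zero, mul_zero]

/-- A full geometric sum of a 2n-th root of unity, nontrivial because n ≤ j + n < 2n. -/
lemma sum_neg_one_pow_mul_exp {n j : ℕ} (hj : j < n) :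
    ∑ i ∈ Finset.range (2 * n), (-1 : ℂ) ^ i *
      Complex.exp ((2 * Real.pi * j * (i / (2 * n)) : ℝ) * Complex.I) = 0 := by
  have hn' : (n : ℂ) ≠ 0 := by exact_mod_cast (by omega : n ≠ 0)
  have hpi : (Real.pi : ℂ) ≠ 0 := by exact_mod_cast Real.pi_ne_zero
  set ζ : ℂ := Complex.exp ((j + n : ℂ) / (2 * n) * (2 * Real.pi * Complex.I)) with hζ
  have e : ∀ i : ℕ, (-1 : ℂ) ^ i *
      Complex.exp ((2 * Real.pi * j * (i / (2 * n)) : ℝ) * Complex.I) = ζ ^ i := by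
    intro i
    rw [hζ, ← Complex.exp_pi_mul_I, ← Complex.exp_nat_mul, ← Complex.exp_nat_mul, ← Complex.exp_add]
    congr 1
    push_cast
    field_simp
    ring
  have h1 : ζ ≠ 1 := by
    rw [hζ, Ne, Complex.exp_eq_one_iff]
    rintro ⟨l, hl⟩
    have h2 : (j + n : ℂ) / (2 * n) = l :=
      mul_right_cancel₀ (mul_ne_zero (mul_ne_zero two_ne_zero hpi) Complex.I_ne_zero) hl
    rw [div_eq_iff (mul_ne_zero two_ne_zero hn')] at h2
    have h3 : (j : ℤ) + n = l * (2 * n) := by exact_mod_cast h2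
    have h4 : 0 < l := by
      by_contra hc
      have : l * (2 * n) ≤ 0 := mul_nonpos_of_nonpos_of_nonneg (by omega) (by omega)
      omega
    nlinarith
  have h2 : ζ ^ (2 * n) = 1 := by
    rw [hζ, ← Complex.exp_nat_mul, Complex.exp_eq_one_iff]
    refine ⟨j + n, ?_⟩
    push_cast
    field_simp
  simp_rw [e]
  rw [geom_sum_eq h1, h2, sub_self, zero_div]

lemma sum_neg_one_pow_mul_trigPoly {n : ℕ} {p : C(UnitAddCircle, ℝ)} (hp : p ∈ trigPoly n) :
    ∑ i ∈ Finset.range (2 * n), (-1 : ℝ) ^ i * p ((i / (2 * n) : ℝ) : UnitAddCircle) = 0 := by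
  obtain ⟨a, b, hab⟩ := hp
  simp_rw [hab, Finset.mul_sum]
  rw [Finset.sum_comm]
  refine Finset.sum_eq_zero fun j hj => ?_
  have h := sum_neg_one_pow_mul_exp (Finset.mem_range.1 hj)
  have e : ∀ i : ℕ, (-1 : ℂ) ^ i * Complex.exp ((2 * Real.pi * j * (i / (2 * n)) : ℝ) * Complex.I)
      = ((((-1 : ℝ) ^ i : ℝ) : ℂ)) *
        Complex.exp ((2 * Real.pi * j * (i / (2 * n)) : ℝ) * Complex.I) :=
    fun i => by push_cast; rfl
  simp_rw [e] at h
  have hre := congrArg Complex.re h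
  have him := congrArg Complex.im h
  rw [Complex.re_sum] at hre
  rw [Complex.im_sum] at him
  simp only [Complex.re_ofReal_mul, Complex.im_ofReal_mul, Complex.exp_ofReal_mul_I_re,
    Complex.exp_ofReal_mul_I_im, Complex.zero_re, Complex.zero_im] at hre him
  have e2 : ∀ i : ℕ, (-1 : ℝ) ^ i * (a j * Real.cos (2 * Real.pi * j * (i / (2 * n)))
      + b j * Real.sin (2 * Real.pi * j * (i / (2 * n))))
      = a j * ((-1 : ℝ) ^ i * Real.cos (2 * Real.pi * j * (i / (2 * n))))
      + b j * ((-1 : ℝ) ^ i * Real.sin (2 * Real.pi * j * (i / (2 * n)))) := fun i => by ring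
  simp_rw [e2]
  rw [Finset.sum_add_distrib, ← Finset.mul_sum, ← Finset.mul_sum, hre, him]
  ring

/-- Duality: the alternating sum over the 2n points i/(2n) annihilates the polynomials, equals 2n on
the cosine, and has norm at most 2n. -/
lemma one_le_bestApprox_cosFun {n : ℕ} (hn : 1 ≤ n) : 1 ≤ bestApprox n (cosFun n) := by
  have hn' : (0 : ℝ) < n := by exact_mod_cast hn
  have : Nonempty (trigPoly n) := ⟨⟨0, 0, 0, fun x => by simp⟩⟩
  refine le_ciInf fun p => ?_
  have hp := sum_neg_one_pow_mul_trigPoly p.2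
  have hc : ∑ i ∈ Finset.range (2 * n), (-1 : ℝ) ^ i * cosFun n ((i / (2 * n) : ℝ) : UnitAddCircle)
      = 2 * n := by
    have e : ∀ i : ℕ, (-1 : ℝ) ^ i * cosFun n ((i / (2 * n) : ℝ) : UnitAddCircle) = 1 := fun i => by
      rw [cosFun_coe, show 2 * Real.pi * n * (i / (2 * n)) = i * Real.pi by field_simp,
        Real.cos_nat_mul_pi, ← mul_pow]
      simp
    simp_rw [e]
    simp
  have hle : ∑ i ∈ Finset.range (2 * n), (-1 : ℝ) ^ i *
      (cosFun n - p.1) ((i / (2 * n) : ℝ) : UnitAddCircle) ≤ 2 * n * ‖cosFun n - p.1‖ := by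
    have : ∀ i ∈ Finset.range (2 * n), (-1 : ℝ) ^ i *
        (cosFun n - p.1) ((i / (2 * n) : ℝ) : UnitAddCircle) ≤ ‖cosFun n - p.1‖ := fun i _ => by
      refine (le_abs_self _).trans ?_
      rw [abs_mul, abs_pow, abs_neg, abs_one, one_pow, one_mul]
      exact (cosFun n - p.1).norm_coe_le_norm _
    refine (Finset.sum_le_sum this).trans (le_of_eq ?_)
    simp
  simp only [ContinuousMap.sub_apply, mul_sub] at hle
  rw [Finset.sum_sub_distrib, hc, hp] at hle
  nlinarith

/-! ### Integral formula for 1 - μ² and its order in k. -/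

/-- Binomial expansion of (e^{iy} - e^{-iy})^{2k}, recentred by i = k + j. -/
lemma sum_choose_mul_cos (k : ℕ) (y : ℝ) :
    ∑ j ∈ Finset.Icc (-(k : ℤ)) (k : ℤ),
      (j.negOnePow : ℝ) * ((2 * k).choose ((k : ℤ) + j).toNat : ℝ) * Real.cos (2 * j * y)
      = (2 * Real.sin y) ^ (2 * k) := by
  have h : (2 * Real.sin y : ℂ) ^ (2 * k) =
      ∑ i ∈ Finset.range (2 * k + 1), (((-1 : ℝ) ^ (i + k) * ((2 * k).choose i : ℝ) : ℝ) : ℂ) *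
        Complex.exp ((2 * (i - k) * y : ℝ) * Complex.I) := by
    have e1 : (2 * Real.sin y : ℂ) * Complex.I =
        Complex.exp (y * Complex.I) + -Complex.exp (-(y * Complex.I)) := by
      rw [Complex.ofReal_sin, Complex.sin, neg_mul]
      linear_combination
        (Complex.exp (-(y * Complex.I)) - Complex.exp (y * Complex.I)) * Complex.I_sq
    have e2 : (2 * Real.sin y : ℂ) ^ (2 * k) =
        (-1) ^ k * ((2 * Real.sin y : ℂ) * Complex.I) ^ (2 * k) := by
      rw [mul_pow _ Complex.I, pow_mul Complex.I, Complex.I_sq, mul_left_comm, ← mul_pow]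
      simp
    rw [e2, e1, add_pow, Finset.mul_sum]
    refine Finset.sum_congr rfl fun i hi => ?_
    have hi' : i ≤ 2 * k := by
      have := Finset.mem_range.1 hi
      omega
    rw [neg_pow (Complex.exp _), ← Complex.exp_nat_mul, ← Complex.exp_nat_mul]
    have e3 : Complex.exp ((2 * (i - k) * y : ℝ) * Complex.I) =
        Complex.exp (i * (y * Complex.I)) * Complex.exp ((2 * k - i : ℕ) * -(y * Complex.I)) := by
      rw [← Complex.exp_add, Nat.cast_sub hi']
      congr 1
      push_cast
      ring
    have e4 : (-1 : ℂ) ^ (2 * k - i) = (-1) ^ i := by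
      have h1 : (-1 : ℂ) ^ (2 * k - i) * (-1) ^ i = 1 := by
        rw [← pow_add, Nat.sub_add_cancel hi']
        simp
      have h2 : (-1 : ℂ) ^ i * (-1) ^ i = 1 := by
        rw [← mul_pow]
        simp
      linear_combination (-1 : ℂ) ^ i * h1 - (-1 : ℂ) ^ (2 * k - i) * h2
    rw [e3, e4]
    push_cast
    ring
  have hre := congrArg Complex.re h
  rw [Complex.re_sum] at hre
  simp only [Complex.re_ofReal_mul, Complex.exp_ofReal_mul_I_re] at hre
  rw [← Complex.ofReal_ofNat, ← Complex.ofReal_mul, ← Complex.ofReal_pow, Complex.ofReal_re] at hre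
  rw [hre]
  refine Finset.sum_nbij' (fun j => ((k : ℤ) + j).toNat) (fun i => (i : ℤ) - k) ?_ ?_ ?_ ?_ ?_
  · intro j hj
    simp only [Finset.mem_Icc, Finset.mem_range] at hj ⊢
    omega
  · intro i hi
    simp only [Finset.mem_Icc, Finset.mem_range] at hi ⊢
    omega
  · intro j hj
    simp only [Finset.mem_Icc] at hj
    omega
  · intro i _
    simp
  · intro j hj
    simp only [Finset.mem_Icc] at hj
    obtain ⟨i, hi⟩ : ∃ i : ℕ, (k : ℤ) + j = i := ⟨((k : ℤ) + j).toNat, by omega⟩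
    have hj2 : j = (i : ℤ) - k := by omega
    subst hj2
    have h1 : ((i : ℤ) - k).negOnePow = ((i + k : ℕ) : ℤ).negOnePow := by
      rw [Int.negOnePow_eq_iff]
      exact ⟨-k, by push_cast; ring⟩
    have h2 : ((k : ℤ) + (i - k)).toNat = i := by omega
    rw [h1, h2, Int.cast_negOnePow_natCast]
    push_cast
    ring_nf

lemma one_sub_mu_sq (k : ℕ) : 1 - mu k ^ 2 =
    4 ^ k / ((2 * k).choose k : ℝ) *
      (8 * ∫ t in (0 : ℝ)..1 / 2, (1 / 2 - t) * Real.sin (Real.pi * t) ^ (2 * k)) := by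
  have hh : (0 : ℝ) < 1 / 2 := by norm_num
  -- Since μ does not depend on n, the symbol at n = 1, with h = 1/2, suffices; 2/h² then gives the
  -- factor 8.
  have h := meanDiffSymbol_self le_rfl k
  rw [Nat.cast_one, mul_one] at h
  have hi : ∀ β : ℝ, Integrable fun t => chiSq (1 / 2) t * Real.cos (β * t) := fun β =>
    (integrable_chiSq hh).mul_bdd (c := 1) (by fun_prop)
      (ae_of_all _ fun t => Real.abs_cos_le_one _)
  have e := integral_chiSq_mul_of_even hh
    (g := fun t => 4 ^ k / ((2 * k).choose k : ℝ) * Real.sin (Real.pi * t) ^ (2 * k)) fun t => by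
      rcases abs_choice t with h | h <;> rw [h]
      rw [mul_neg, Real.sin_neg, Even.neg_pow (even_two_mul k)]
  rw [← h, meanDiffSymbol]
  simp_rw [← integral_const_mul]
  rw [← integral_finsetSum _ fun j _ => (hi _).const_mul _]
  refine Eq.trans (integral_congr_ae (ae_of_all _ fun t => ?_)) (e.trans ?_)
  · have hs := sum_choose_mul_cos k (Real.pi * t)
    rw [mul_pow, pow_mul 2, show (2 : ℝ) ^ 2 = 4 by norm_num] at hs
    rw [div_mul_eq_mul_div, ← hs, Finset.sum_div, Finset.mul_sum]
    refine Finset.sum_congr rfl fun j _ => ?_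
    rw [diffCoeff, show 2 * (j : ℝ) * (Real.pi * t) = 2 * Real.pi * ((1 : ℕ) : ℤ) * j * t by
      push_cast; ring]
    ring
  · rw [← intervalIntegral.integral_const_mul, ← intervalIntegral.integral_const_mul,
      ← intervalIntegral.integral_const_mul]
    refine intervalIntegral.integral_congr fun t _ => ?_
    ring

lemma integral_cos_mul_sin_pow (k : ℕ) :
    ∫ t in (0 : ℝ)..1 / 2, Real.cos (Real.pi * t) * Real.sin (Real.pi * t) ^ (2 * k)
      = 1 / (Real.pi * (2 * k + 1)) := by
  have hpi := Real.pi_ne_zero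
  have hd : ∀ t ∈ Set.uIcc (0 : ℝ) (1 / 2), HasDerivAt
      (fun t => Real.sin (Real.pi * t) ^ (2 * k + 1) / (Real.pi * (2 * k + 1)))
      (Real.cos (Real.pi * t) * Real.sin (Real.pi * t) ^ (2 * k)) t := by
    intro t _
    have hid : HasDerivAt (fun t : ℝ => Real.pi * t) (Real.pi * 1) t :=
      (hasDerivAt_id t).const_mul _
    refine ((hid.sin.pow (2 * k + 1)).div_const _).congr_deriv ?_
    have : (2 * (k : ℝ) + 1) ≠ 0 := by positivity
    push_cast
    field_simp
  rw [intervalIntegral.integral_eq_sub_of_hasDerivAt hd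
    (Continuous.intervalIntegrable (by fun_prop) _ _)]
  rw [show Real.pi * (1 / 2) = Real.pi / 2 by ring, Real.sin_pi_div_two]
  simp

/-- Since cos πt = sin π(1/2 - t), the inequalities sin x ≤ x and sin x ≥ 2x/π put 1/2 - t between
(1/π)cos πt and (1/2)cos πt, and cos πt · sin^{2k}(πt) has an elementary primitive. -/
lemma integral_bounds (k : ℕ) :
    1 / (Real.pi ^ 2 * (2 * k + 1)) ≤
      ∫ t in (0 : ℝ)..1 / 2, (1 / 2 - t) * Real.sin (Real.pi * t) ^ (2 * k) ∧
    ∫ t in (0 : ℝ)..1 / 2, (1 / 2 - t) * Real.sin (Real.pi * t) ^ (2 * k) ≤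
      1 / (2 * Real.pi * (2 * k + 1)) := by
  have hpi := Real.pi_pos
  have hI := integral_cos_mul_sin_pow k
  have hc : ∀ t, Real.cos (Real.pi * t) = Real.sin (Real.pi * (1 / 2 - t)) := fun t => by
    rw [← Real.sin_pi_div_two_sub]; ring_nf
  have hs : ∀ t, 0 ≤ Real.sin (Real.pi * t) ^ (2 * k) := fun t => by
    rw [pow_mul]; positivity
  constructor
  · have : 1 / (Real.pi ^ 2 * (2 * k + 1)) = ∫ t in (0 : ℝ)..1 / 2,
        1 / Real.pi * (Real.cos (Real.pi * t) * Real.sin (Real.pi * t) ^ (2 * k)) := by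
      rw [intervalIntegral.integral_const_mul, hI]
      field_simp
    rw [this]
    refine intervalIntegral.integral_mono_on (by norm_num)
      (Continuous.intervalIntegrable (by fun_prop) _ _)
      (Continuous.intervalIntegrable (by fun_prop) _ _) fun t ht => ?_
    rw [← mul_assoc]
    refine mul_le_mul_of_nonneg_right ?_ (hs t)
    rw [hc, one_div_mul_eq_div, div_le_iff₀ hpi, mul_comm (1 / 2 - t)]
    exact Real.sin_le (mul_nonneg hpi.le (by linarith [ht.2]))
  · have : 1 / (2 * Real.pi * (2 * k + 1)) = ∫ t in (0 : ℝ)..1 / 2,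
        1 / 2 * (Real.cos (Real.pi * t) * Real.sin (Real.pi * t) ^ (2 * k)) := by
      rw [intervalIntegral.integral_const_mul, hI]
      field_simp
    rw [this]
    refine intervalIntegral.integral_mono_on (by norm_num)
      (Continuous.intervalIntegrable (by fun_prop) _ _)
      (Continuous.intervalIntegrable (by fun_prop) _ _) fun t ht => ?_
    rw [← mul_assoc]
    refine mul_le_mul_of_nonneg_right ?_ (hs t)
    rw [hc]
    have := Real.mul_le_sin (x := Real.pi * (1 / 2 - t)) (mul_nonneg hpi.le (by linarith [ht.2]))
      (by nlinarith [ht.1])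
    have e : 2 / Real.pi * (Real.pi * (1 / 2 - t)) = 2 * (1 / 2 - t) := by field_simp
    linarith

lemma mu_sq_lt_one (k : ℕ) : mu k ^ 2 < 1 := by
  have h := one_sub_mu_sq k
  have hc : (0 : ℝ) < (2 * k).choose k := by exact_mod_cast Nat.choose_pos (by omega)
  have hJ : 0 < ∫ t in (0 : ℝ)..1 / 2, (1 / 2 - t) * Real.sin (Real.pi * t) ^ (2 * k) :=
    lt_of_lt_of_le (by have := Real.pi_pos; positivity) (integral_bounds k).1
  have : 0 < 1 - mu k ^ 2 := by rw [h]; positivity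
  linarith

/-! ### Central binomial coefficients and the order of the constants. -/

/-- The recurrence for central binomials reduces the induction step to (2k+1)(2k+3) ≤ 4(k+1)². -/
lemma centralBinom_sq_mul_le (k : ℕ) : k.centralBinom ^ 2 * (2 * k + 1) ≤ 16 ^ k := by
  induction k with
  | zero => simp
  | succ k ih =>
    have h := Nat.succ_mul_centralBinom_succ k
    have h2 : (k + 1) ^ 2 * ((k + 1).centralBinom ^ 2 * (2 * (k + 1) + 1)) ≤
        (k + 1) ^ 2 * 16 ^ (k + 1) := by
      calc (k + 1) ^ 2 * ((k + 1).centralBinom ^ 2 * (2 * (k + 1) + 1))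
          = ((k + 1) * (k + 1).centralBinom) ^ 2 * (2 * k + 3) := by ring
        _ = k.centralBinom ^ 2 * (2 * k + 1) * (4 * ((2 * k + 1) * (2 * k + 3))) := by rw [h]; ring
        _ ≤ 16 ^ k * (4 * (4 * (k + 1) ^ 2)) := Nat.mul_le_mul ih (by nlinarith)
        _ = (k + 1) ^ 2 * 16 ^ (k + 1) := by ring
    exact Nat.le_of_mul_le_mul_left h2 (by positivity)

/-- The induction step is 4k(k+1) ≤ (2k+1)²; equality holds at k = 1. -/
lemma sixteen_pow_le {k : ℕ} (hk : 1 ≤ k) : 16 ^ k ≤ 4 * k * k.centralBinom ^ 2 := by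
  induction k, hk using Nat.le_induction with
  | base => simp [Nat.centralBinom, Nat.choose]
  | succ k _ ih =>
    have h := Nat.succ_mul_centralBinom_succ k
    have h2 : (k + 1) * 16 ^ (k + 1) ≤ (k + 1) * (4 * (k + 1) * (k + 1).centralBinom ^ 2) := by
      calc (k + 1) * 16 ^ (k + 1) = 16 * (k + 1) * 16 ^ k := by ring
        _ ≤ 16 * (k + 1) * (4 * k * k.centralBinom ^ 2) := Nat.mul_le_mul_left _ ih
        _ ≤ 4 * (2 * (2 * k + 1) * k.centralBinom) ^ 2 := by
          have : 16 * (k + 1) * (4 * k) ≤ 16 * (2 * k + 1) ^ 2 := by nlinarith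
          have := Nat.mul_le_mul_right (k.centralBinom ^ 2) this
          nlinarith
        _ = (k + 1) * (4 * (k + 1) * (k + 1).centralBinom ^ 2) := by rw [← h]; ring
    exact Nat.le_of_mul_le_mul_left h2 (by positivity)

lemma gammaStar_two_mul (k : ℕ) : gammaStar (2 * k) = ((2 * k).choose k : ℝ)⁻¹ := by
  rw [gammaStar, Nat.mul_div_cancel_left k two_pos]

lemma gammaStar_pos (k : ℕ) : 0 < gammaStar (2 * k) := by
  rw [gammaStar_two_mul, inv_pos]
  exact_mod_cast Nat.choose_pos (by omega)

lemma gammaStar_div_bounds {k : ℕ} (hk : 1 ≤ k) :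
    1 / 2 * (((2 * k : ℕ) : ℝ) / 2 ^ (2 * k)) ≤ gammaStar (2 * k) / (1 - mu k ^ 2) ∧
    gammaStar (2 * k) / (1 - mu k ^ 2) ≤ 3 * (((2 * k : ℕ) : ℝ) / 2 ^ (2 * k)) := by
  have hpi := Real.pi_pos
  have hk' : (1 : ℝ) ≤ k := by exact_mod_cast hk
  have hc : (0 : ℝ) < (2 * k).choose k := by exact_mod_cast Nat.choose_pos (by omega)
  obtain ⟨h1, h2⟩ := integral_bounds k
  have e := one_sub_mu_sq k
  set J := ∫ t in (0 : ℝ)..1 / 2, (1 / 2 - t) * Real.sin (Real.pi * t) ^ (2 * k)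
  have hJ : 0 < J := lt_of_lt_of_le (by positivity) h1
  have h4 : (2 : ℝ) ^ (2 * k) = 4 ^ k := by rw [pow_mul]; norm_num
  -- The central binomial cancels, so this quotient needs only the order of J.
  have hX : gammaStar (2 * k) / (1 - mu k ^ 2) = 1 / (8 * J) / 4 ^ k := by
    rw [e, gammaStar_two_mul]
    field_simp
  rw [hX, h4, ← mul_div_assoc, ← mul_div_assoc]
  push_cast
  constructor
  · gcongr
    rw [le_div_iff₀ (by positivity)]
    rw [le_div_iff₀ (by positivity)] at h2
    have h3 : 3 * J * (2 * (2 * k + 1)) ≤ 1 := by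
      refine le_trans ?_ h2
      have := mul_le_mul_of_nonneg_left Real.pi_gt_three.le
        (by positivity : 0 ≤ J * (2 * (2 * (k : ℝ) + 1)))
      linarith
    nlinarith
  · gcongr
    rw [div_le_iff₀ (by positivity)]
    rw [div_le_iff₀ (by positivity)] at h1
    have h3 : 1 ≤ J * (16 * (2 * k + 1)) := by
      refine h1.trans ?_
      gcongr
      nlinarith [Real.pi_le_four]
    nlinarith

lemma sqrt_mul_gammaStar_bounds {k : ℕ} (hk : 1 ≤ k) :
    ((2 * k : ℕ) : ℝ) / 2 ^ (2 * k) ≤ Real.sqrt ((2 * k : ℕ) : ℝ) * gammaStar (2 * k) ∧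
    Real.sqrt ((2 * k : ℕ) : ℝ) * gammaStar (2 * k) ≤ 2 * (((2 * k : ℕ) : ℝ) / 2 ^ (2 * k)) := by
  have hk' : (1 : ℝ) ≤ k := by exact_mod_cast hk
  have hc : (0 : ℝ) < (2 * k).choose k := by exact_mod_cast Nat.choose_pos (by omega)
  have h1 : ((2 * k).choose k : ℝ) ^ 2 * (2 * k + 1) ≤ 16 ^ k := by
    exact_mod_cast centralBinom_sq_mul_le k
  have h2 : (16 : ℝ) ^ k ≤ 4 * k * ((2 * k).choose k : ℝ) ^ 2 := by
    exact_mod_cast sixteen_pow_le hk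
  have h4 : ((2 : ℝ) ^ (2 * k)) ^ 2 = 16 ^ k := by 
    rw [← pow_mul, mul_comm (2 * k), ← mul_assoc, pow_mul]; norm_num
  rw [gammaStar_two_mul]
  constructor
  · refine (pow_le_pow_iff_left₀ (by positivity) (by positivity) two_ne_zero).1 ?_
    rw [mul_pow, div_pow, h4, Real.sq_sqrt (by positivity), inv_pow, ← div_eq_mul_inv,
      div_le_div_iff₀ (by positivity) (by positivity)]
    push_cast
    nlinarith
  · refine (pow_le_pow_iff_left₀ (by positivity) (by positivity) two_ne_zero).1 ?_
    rw [mul_pow, mul_pow, div_pow, h4, Real.sq_sqrt (by positivity), inv_pow, ← div_eq_mul_inv,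
      ← mul_div_assoc, div_le_div_iff₀ (by positivity) (by positivity)]
    push_cast
    nlinarith

/-! ### The sharp constant in extended nonnegative reals. -/

lemma iSup_enorm_meanDiff (k : ℕ) {h : ℝ} (hh : 0 < h) (f : C(UnitAddCircle, ℝ)) :
    ⨆ x : UnitAddCircle, ‖(gammaStar (2 * k))⁻¹ * W k f (chiSq h) x‖ₑ
      = ENNReal.ofReal ((gammaStar (2 * k))⁻¹ * ‖meanDiff k h f‖) := by
  have hg := gammaStar_pos k
  have e : ∀ x, ‖(gammaStar (2 * k))⁻¹ * W k f (chiSq h) x‖ₑ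
      = ENNReal.ofReal ((gammaStar (2 * k))⁻¹ * ‖meanDiff k h f x‖) := fun x => by
    rw [← meanDiff_apply hh, ← ofReal_norm, norm_mul,
      Real.norm_of_nonneg (inv_pos.2 hg).le]
  simp_rw [e]
  refine le_antisymm (iSup_le fun x => ?_) ?_
  · gcongr
    exact (meanDiff k h f).norm_coe_le_norm x
  · obtain ⟨x, -, hx⟩ := isCompact_univ.exists_isMaxOn (Set.univ_nonempty (α := UnitAddCircle))
      (f := fun x => ‖meanDiff k h f x‖) (by fun_prop)
    refine le_trans ?_ (le_iSup _ x)
    gcongr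
    exact (ContinuousMap.norm_le _ (norm_nonneg _)).2 fun y => hx (Set.mem_univ y)

lemma Kstar_chiSq_le {k n : ℕ} (hn : 1 ≤ n) :
    Kstar n k (chiSq (1 / (2 * (n : ℝ)))) ≤
      ENNReal.ofReal (4 / Real.pi * (gammaStar (2 * k) / (1 - mu k ^ 2))) := by
  have hn' : (0 : ℝ) < n := by exact_mod_cast hn
  have hg := gammaStar_pos k
  have hmu := sub_pos.2 (mu_sq_lt_one k)
  refine iSup_le fun f => ENNReal.div_le_of_le_mul ?_
  rw [iSup_enorm_meanDiff k (by positivity), ← ENNReal.ofReal_mul (by positivity)]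
  refine ENNReal.ofReal_le_ofReal
    ((bestApprox_le_norm_meanDiff hn (mu_sq_lt_one k) f).trans (le_of_eq ?_))
  field_simp

lemma le_Kstar_chiSq {k n : ℕ} (hn : 1 ≤ n) :
    ENNReal.ofReal (gammaStar (2 * k) / (1 - mu k ^ 2)) ≤
      Kstar n k (chiSq (1 / (2 * (n : ℝ)))) := by
  have hn' : (0 : ℝ) < n := by exact_mod_cast hn
  have hg := gammaStar_pos k
  have hmu := sub_pos.2 (mu_sq_lt_one k)
  refine le_trans ?_ (le_iSup _ (cosFun n))
  rw [iSup_enorm_meanDiff k (by positivity), meanDiff_cosFun hn, norm_smul,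
    Real.norm_of_nonneg hmu.le]
  calc ENNReal.ofReal (gammaStar (2 * k) / (1 - mu k ^ 2))
      = ENNReal.ofReal 1 / ENNReal.ofReal ((gammaStar (2 * k))⁻¹ * (1 - mu k ^ 2)) := by
        rw [← ENNReal.ofReal_div_of_pos (by positivity)]
        congr 1
        field_simp
    _ ≤ _ := by
        refine ENNReal.div_le_div (ENNReal.ofReal_le_ofReal (one_le_bestApprox_cosFun hn))
          (ENNReal.ofReal_le_ofReal ?_)
        rw [← mul_assoc]
        exact mul_le_of_le_one_right (by positivity) (norm_cosFun_le n)

end Stechkin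

end

theorem theorem6 :
    -- the two-sided bound, for `r = 2k` and every `n ≥ 1`
    (∀ k n : ℕ, 1 ≤ k → 1 ≤ n →
      ENNReal.ofReal (Stechkin.gammaStar (2 * k) / (1 - Stechkin.mu k ^ 2))
          ≤ Stechkin.Kstar n k (Stechkin.chiSq (1 / (2 * (n : ℝ)))) ∧
      Stechkin.Kstar n k (Stechkin.chiSq (1 / (2 * (n : ℝ))))
          ≤ ENNReal.ofReal
              (4 / Real.pi * (Stechkin.gammaStar (2 * k) / (1 - Stechkin.mu k ^ 2)))) ∧
    -- the order of the bound in `r = 2k`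
    (∃ c C : ℝ, 0 < c ∧ 0 < C ∧ ∀ k : ℕ, 1 ≤ k →
      c * (Real.sqrt ((2 * k : ℕ) : ℝ) * Stechkin.gammaStar (2 * k))
          ≤ Stechkin.gammaStar (2 * k) / (1 - Stechkin.mu k ^ 2) ∧
      Stechkin.gammaStar (2 * k) / (1 - Stechkin.mu k ^ 2)
          ≤ C * (Real.sqrt ((2 * k : ℕ) : ℝ) * Stechkin.gammaStar (2 * k))) ∧
    (∃ c C : ℝ, 0 < c ∧ 0 < C ∧ ∀ k : ℕ, 1 ≤ k →
      c * (((2 * k : ℕ) : ℝ) / 2 ^ (2 * k))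
          ≤ Real.sqrt ((2 * k : ℕ) : ℝ) * Stechkin.gammaStar (2 * k) ∧
      Real.sqrt ((2 * k : ℕ) : ℝ) * Stechkin.gammaStar (2 * k)
          ≤ C * (((2 * k : ℕ) : ℝ) / 2 ^ (2 * k))) := by
  refine ⟨fun k n _ hn => ⟨Stechkin.le_Kstar_chiSq hn, Stechkin.Kstar_chiSq_le hn⟩,
    -- Quotients of the constants in the two comparisons with r/2^r: 1/4 = (1/2)/2 and 3 = 3/1.
    ⟨1 / 4, 3, by norm_num, by norm_num, fun k hk => ?_⟩,
    ⟨1, 2, one_pos, two_pos, fun k hk => ?_⟩⟩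
  · obtain ⟨h1, h2⟩ := Stechkin.gammaStar_div_bounds hk
    obtain ⟨h3, h4⟩ := Stechkin.sqrt_mul_gammaStar_bounds hk
    constructor <;> linarith
  · rw [one_mul]
    exact Stechkin.sqrt_mul_gammaStar_bounds hk
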